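/- Let $X$ be a compact Hermitian manifold, that is, a compact Hausdorff complex manifold with a smooth Riemannian metric $g$ satisfying $g(Ju,Jv)=g(u,v)$ for the complex structure $J$, and let $\omega(u,v)=g(Ju,v)$ be its Kähler form. For a holomorphic map $f:\mathbb{C}\to X$ define $|df|(z)\ge 0$ by $f^*\omega=|df|^2\,dx\,dy$, where $z=x+iy$. Let $\mathcal{M}(X)$ be the space of Brody curves, i.e. of holomorphic maps $f:\mathbb{C}\to X$ with $|df|\le 1$ everywhere, with the compact-open topology and the action of $\mathbb{C}$ given by $(a,f(z))\mapsto f(z+a)$. For $f\in\mathcal{M}(X)$ put $$\rho(f)=\lim_{R\to\infty}\frac{1}{\pi R^2}\sup_{a\in\mathbb{C}}\int_{|z-a|<R}|df|^2\,dx\,dy,\qquad T(r,f)=\int_1^r\Big(\int_{|z|<t}|df|^2\,dx\,dy\Big)\frac{dt}{t}\quad(r\ge 1),$$ $$\rho_{\mathrm{NSA}}(f)=\limsup_{r\to\infty}\frac{2}{\pi r^2}T(r,f),\qquad \underline{\rho}_{\mathrm{NSA}}(f)=\liminf_{r\to\infty}\frac{2}{\pi r^2}T(r,f).$$ For $\mathcal{N}\subset\mathcal{M}(X)$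 let $\rho(\mathcal{N})$, $\rho_{\mathrm{NSA}}(\mathcal{N})$, $\underline{\rho}_{\mathrm{NSA}}(\mathcal{N})$ be the suprema of $\rho(f)$, $\rho_{\mathrm{NSA}}(f)$, $\underline{\rho}_{\mathrm{NSA}}(f)$ over $f\in\mathcal{N}$ (taken in $[0,\infty]$, so that they are $0$ if $\mathcal{N}$ is empty). Theorem. For every $f\in\mathcal{M}(X)$ the limit defining $\rho(f)$ exists and is finite, and, with $\overline{\mathbb{C}\cdot f}$ the closure in $\mathcal{M}(X)$ of the $\mathbb{C}$-orbit of $f$, $$\rho(f)=\rho(\overline{\mathbb{C}\cdot f})=\rho_{\mathrm{NSA}}(\overline{\mathbb{C}\cdot f})=\underline{\rho}_{\mathrm{NSA}}(\overline{\mathbb{C}\cdot f}).$$ Hence for every closed $\mathbb{C}$-invariant subset $\mathcal{N}\subset\mathcal{M}(X)$ the three quantities $\rho(\mathcal{N})$, $\rho_{\mathrm{NSA}}(\mathcal{N})$, $\underline{\rho}_{\mathrm{NSA}}(\mathcal{N})$ are finite and $$\rho(\mathcal{N})=\rho_{\mathrm{NSA}}(\mathcal{N})=\underline{\rho}_{\mathrm{NSA}}(\mathcal{N}).$$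 -/

import Mathlib

open Set Filter Topology MeasureTheory
open scoped Manifold ContDiff ENNReal

noncomputable section

namespace Brody

/-- The underlying real manifold of a complex manifold is a real analytic manifold. -/
instance instIsManifoldReal {E : Type*} [NormedAddCommGroup E] [NormedSpace ℂ E]
    {X : Type*} [TopologicalSpace X] [ChartedSpace E X] [hX : IsManifold 𝓘(ℂ, E) ω X] :
    IsManifold 𝓘(ℝ, E) ω X := by
  apply isManifold_of_contDiffOn
  intro e e' he he'
  have h := (contDiffGroupoid ω 𝓘(ℂ, E)).compatible he he'
  rw [contDiffGroupoid, mem_groupoid_of_pregroupoid] at h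
  exact ContDiffOn.restrict_scalars (𝕜' := ℂ) ℝ h.1

/-- A map that is complex differentiable is real differentiable on the underlying real
manifolds. -/
theorem mdifferentiable_real {E : Type*} [NormedAddCommGroup E] [NormedSpace ℂ E]
    {X : Type*} [TopologicalSpace X] [ChartedSpace E X] {f : ℂ → X}
    (hf : MDifferentiable 𝓘(ℂ, ℂ) 𝓘(ℂ, E) f) : MDifferentiable 𝓘(ℝ, ℂ) 𝓘(ℝ, E) f := by
  intro z
  have h := (mdifferentiableAt_iff _ _).1 (hf z)
  refine (mdifferentiableAt_iff _ _).2 ⟨h.1, ?_⟩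
  exact DifferentiableWithinAt.restrictScalars ℝ h.2

/-- The complex structure `J` (multiplication by `i`) on the real tangent spaces of a complex
manifold. The tangent space at `x` is read in the preferred holomorphic chart at `x`. -/
def J {E : Type*} [NormedAddCommGroup E] [NormedSpace ℂ E]
    {X : Type*} [TopologicalSpace X] [ChartedSpace E X] (x : X)
    (v : TangentSpace 𝓘(ℝ, E) x) : TangentSpace 𝓘(ℝ, E) x :=
  (Complex.I • (show E from v) : E)

/-- A Hermitian metric on a complex manifold: a smooth Riemannian metric `g` on the underlying real
manifold with `g (J u) (J v) = g u v`. -/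
structure HermitianMetric (E : Type*) [NormedAddCommGroup E] [NormedSpace ℂ E]
    (X : Type*) [TopologicalSpace X] [ChartedSpace E X] [IsManifold 𝓘(ℂ, E) ω X] extends
    Bundle.ContMDiffRiemannianMetric 𝓘(ℝ, E) ∞ E (fun x : X ↦ TangentSpace 𝓘(ℝ, E) x) where
  inner_J : ∀ (x : X) (u v : TangentSpace 𝓘(ℝ, E) x), inner x (J x u) (J x v) = inner x u v

section Curves

variable {E : Type*} [NormedAddCommGroup E] [NormedSpace ℂ E]
  {X : Type*} [TopologicalSpace X] [ChartedSpace E X] [IsManifold 𝓘(ℂ, E) ω X]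

/-- The Kähler form `ω (u, v) = g (J u, v)` of a Hermitian metric. -/
def kahlerForm (g : HermitianMetric E X) (x : X) (u v : TangentSpace 𝓘(ℝ, E) x) : ℝ :=
  g.inner x (J x u) v

/-- The function `φ` with `f^* ω = φ dx dy`, that is, the pullback of the Kähler form evaluated on
the coordinate vectors `∂/∂x = 1` and `∂/∂y = i` of `ℂ`. -/
def pullbackDensity (g : HermitianMetric E X) (f : ℂ → X) (z : ℂ) : ℝ :=
  kahlerForm g (f z) (mfderiv 𝓘(ℝ, ℂ) 𝓘(ℝ, E) f z (1 : ℂ))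
    (mfderiv 𝓘(ℝ, ℂ) 𝓘(ℝ, E) f z (Complex.I : ℂ))

/-- The spherical derivative `|df| (z) ≥ 0`, with `f^* ω = |df|² dx dy`. -/
def sphericalDeriv (g : HermitianMetric E X) (f : ℂ → X) (z : ℂ) : ℝ :=
  √(pullbackDensity g f z)

/-- The space `ℳ(X)` of Brody curves: holomorphic maps `f : ℂ → X` with `|df| ≤ 1`. As a set of
continuous maps it carries the compact-open topology. -/
def brodyCurves (g : HermitianMetric E X) : Set C(ℂ, X) :=
  {f | MDifferentiable 𝓘(ℂ, ℂ) 𝓘(ℂ, E) f ∧ ∀ z, sphericalDeriv g f z ≤ 1}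

theorem sphericalDeriv_translate (g : HermitianMetric E X) {f : ℂ → X}
    (hf : MDifferentiable 𝓘(ℂ, ℂ) 𝓘(ℂ, E) f) (a z : ℂ) :
    sphericalDeriv g (fun w ↦ f (w + a)) z = sphericalDeriv g f (z + a) := by
  have h2 : HasMFDerivAt 𝓘(ℝ, ℂ) 𝓘(ℝ, ℂ) (fun w : ℂ ↦ w + a) z
      (ContinuousLinearMap.id ℝ ℂ) :=
    ((hasFDerivAt_id z).add_const a).hasMFDerivAt
  have h1 := (mdifferentiable_real hf (z + a)).hasMFDerivAt
  have h3 := (HasMFDerivAt.comp z h1 h2).mfderiv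
  have h4 : mfderiv 𝓘(ℝ, ℂ) 𝓘(ℝ, E) (fun w ↦ f (w + a)) z
      = mfderiv 𝓘(ℝ, ℂ) 𝓘(ℝ, E) f (z + a) := h3
  unfold sphericalDeriv pullbackDensity
  rw [h4]
  rfl

/-- The action of `ℂ` on the space of Brody curves, `(a, f) ↦ f (· + a)`. -/
instance instAddActionBrodyCurves (g : HermitianMetric E X) : AddAction ℂ (brodyCurves g) where
  vadd a f := ⟨⟨fun z ↦ f.1 (z + a), by fun_prop⟩,
    f.2.1.comp ((differentiable_id.add_const a).mdifferentiable), fun z ↦ by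
      have h := sphericalDeriv_translate g f.2.1 a z
      exact h.trans_le (f.2.2 (z + a))⟩
  zero_vadd f := by
    apply Subtype.ext
    ext z
    exact congrArg f.1 (add_zero z)
  add_vadd a b f := by
    apply Subtype.ext
    ext z
    exact congrArg f.1 (by rw [add_assoc z a b])

/-- The energy `∫_{|z - a| < R} |df|² dx dy`. -/
def energy (g : HermitianMetric E X) (f : brodyCurves g) (a : ℂ) (R : ℝ) : ℝ≥0∞ :=
  ∫⁻ z in Metric.ball a R, ENNReal.ofReal (sphericalDeriv g f.1 z ^ 2)

/-- The mean energy `(π R²)⁻¹ sup_a ∫_{|z - a| < R} |df|² dx dy`. -/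
def meanEnergy (g : HermitianMetric E X) (f : brodyCurves g) (R : ℝ) : ℝ≥0∞ :=
  ENNReal.ofReal (1 / (Real.pi * R ^ 2)) * ⨆ a : ℂ, energy g f a R

/-- The energy density `ρ(f) = lim_{R → ∞} (π R²)⁻¹ sup_a ∫_{|z - a| < R} |df|² dx dy`. -/
def rho (g : HermitianMetric E X) (f : brodyCurves g) : ℝ≥0∞ :=
  limUnder atTop (meanEnergy g f)

/-- The Nevanlinna–Shimizu–Ahlfors characteristic
`T(r, f) = ∫_1^r (∫_{|z| < t} |df|² dx dy) dt / t` for `r ≥ 1`. -/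
def nsaCharacteristic (g : HermitianMetric E X) (r : ℝ) (f : brodyCurves g) : ℝ≥0∞ :=
  ∫⁻ t in Ioc 1 r, energy g f 0 t / ENNReal.ofReal t

/-- `ρ_NSA(f) = limsup_{r → ∞} 2 / (π r²) T(r, f)`. -/
def rhoNSA (g : HermitianMetric E X) (f : brodyCurves g) : ℝ≥0∞ :=
  limsup (fun r : ℝ ↦ ENNReal.ofReal (2 / (Real.pi * r ^ 2)) * nsaCharacteristic g r f) atTop

/-- The lower variant of `ρ_NSA(f)`, `liminf_{r → ∞} 2 / (π r²) T(r, f)`. -/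
def lowerRhoNSA (g : HermitianMetric E X) (f : brodyCurves g) : ℝ≥0∞ :=
  liminf (fun r : ℝ ↦ ENNReal.ofReal (2 / (Real.pi * r ^ 2)) * nsaCharacteristic g r f) atTop

/-- `ρ(𝒩)`, the supremum of `ρ(f)` over `f ∈ 𝒩`. -/
def rhoSet (g : HermitianMetric E X) (N : Set (brodyCurves g)) : ℝ≥0∞ :=
  ⨆ f ∈ N, rho g f

/-- `ρ_NSA(𝒩)`, the supremum of `ρ_NSA(f)` over `f ∈ 𝒩`. -/
def rhoNSASet (g : HermitianMetric E X) (N : Set (brodyCurves g)) : ℝ≥0∞ :=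
  ⨆ f ∈ N, rhoNSA g f

/-- The supremum of the lower `ρ_NSA(f)` over `f ∈ 𝒩`. -/
def lowerRhoNSASet (g : HermitianMetric E X) (N : Set (brodyCurves g)) : ℝ≥0∞ :=
  ⨆ f ∈ N, lowerRhoNSA g f

/-- The closure, in the space of Brody curves, of the orbit of `f` under the action of `ℂ`. -/
def orbitClosure (g : HermitianMetric E X) (f : brodyCurves g) : Set (brodyCurves g) :=
  closure (AddAction.orbit ℂ f)

end Curves

end Brody

end

/-!
The proof splits into compactness of the space of Brody curves and a statement in potential theory
about the single function `φ = |df|²`, of which only `0 ≤ φ ≤ 1` and measurability matter.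

**Compactness.** As `f` is holomorphic, `|df|²` is `g (∂f/∂x, ∂f/∂x)`, so a Brody curve is
`2`-Lipschitz for the Riemannian distance. By Arzelà–Ascoli and Weierstrass' theorem on locally
uniform limits (applied in charts), `ℳ(X)` is compact (`isCompact_brodyCurves`) and `|df| (z)`
depends continuously on `f` (`continuous_sphericalDeriv`), hence so do the energies and the
characteristics `T (r, ·)`.

**Easy inequalities.** Averaging disc masses over a larger disc (`volume_mul_ballMass_le`) gives
`meanMass φ L ≤ (1 + r / L)² * meanMass φ r`, so the limit `ρ(f)` exists and is the infimum of the
mean energies. Then `ρ_NSA(f) ≤ ρ(f)` by integration, and `ρ(h) ≤ ρ(f)` for `h` in the orbit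
closure of `f`, because the condition `∫_{|z - a| < R} |dh|² ≤ sup_b ∫_{|z - b| < R} |df|²` is
closed and translation invariant.

**The main inequality.** Given `c < ρ(f)`, a curve `h` in the orbit closure with `T (r, h) ≥ c π r²
/ 2 - O(1)` for all `r` is needed. By averaging again, for every `R` some translate of `f` has
`∫_0^R (∫_{|z| < t} φ) dt / t ≥ (c + δ) π R² / 2`. Let `F` be the Green potential of `φ` on the
disc of radius `R`, so that `ΔF = -2πφ`. By Jensen's formula for circle means of `log |z - w|`, `F
(a)` exceeds the mean of `F` over the circle of radius `r` about `a` by exactly `∫_0^r (∫_{|z - a|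
< t} φ) dt / t`. Let `a` be an almost maximal point of `H (z) = F (z) + c π (|z|² - R²) / 2`. The
mean of `H` over the circle is at most `sup H`, so that this integral is at least `c π r² / 2 - ε`
for *every* circle inside the disc. Moreover `H (0) ≥ δ π R² / 2`, whereas `F (z) ≤ 4 π R √(R² -
|z|²)`; hence `a` has distance at least a constant times `R` from the boundary
(`exists_forall_le_logMass`). Translating `a` to the origin and letting `R → ∞`, a limit curve has
the required property for all `r` (`exists_le_lowerRhoNSA`).
-/

noncomputable section

namespace Brody

/-! ### Hermitian metrics and holomorphic curves -/

section Geometry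

open Bundle

variable {E : Type*} [NormedAddCommGroup E] [NormedSpace ℂ E]
  {X : Type*} [TopologicalSpace X] [ChartedSpace E X]

/-- The Cauchy–Riemann equations `∂f/∂y = J ∂f/∂x`. -/
theorem mfderiv_I {f : ℂ → X} (hf : MDifferentiable 𝓘(ℂ, ℂ) 𝓘(ℂ, E) f) (z : ℂ) :
    mfderiv 𝓘(ℝ, ℂ) 𝓘(ℝ, E) f z (Complex.I : ℂ) =
      J (f z) (mfderiv 𝓘(ℝ, ℂ) 𝓘(ℝ, E) f z (1 : ℂ)) := by
  have h1 := (hf z).hasMFDerivAt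
  have h2 : HasMFDerivAt 𝓘(ℝ, ℂ) 𝓘(ℝ, E) f z
      ((show ℂ →L[ℂ] E from mfderiv 𝓘(ℂ, ℂ) 𝓘(ℂ, E) f z).restrictScalars ℝ) :=
    ⟨h1.1, h1.2.restrictScalars ℝ⟩
  rw [h2.mfderiv]
  change (show ℂ →L[ℂ] E from mfderiv 𝓘(ℂ, ℂ) 𝓘(ℂ, E) f z) Complex.I =
    Complex.I • (show ℂ →L[ℂ] E from mfderiv 𝓘(ℂ, ℂ) 𝓘(ℂ, E) f z) 1
  rw [← map_smul, smul_eq_mul, mul_one]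

variable [IsManifold 𝓘(ℂ, E) ω X]

/-- Since `∂f/∂y = J ∂f/∂x`, the density of `f^* ω` is the squared length of `∂f/∂x`. -/
theorem pullbackDensity_eq (g : HermitianMetric E X) {f : ℂ → X}
    (hf : MDifferentiable 𝓘(ℂ, ℂ) 𝓘(ℂ, E) f) (z : ℂ) :
    pullbackDensity g f z = g.inner (f z) (mfderiv 𝓘(ℝ, ℂ) 𝓘(ℝ, E) f z (1 : ℂ))
      (mfderiv 𝓘(ℝ, ℂ) 𝓘(ℝ, E) f z (1 : ℂ)) := by
  unfold pullbackDensity kahlerForm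
  rw [mfderiv_I hf, g.inner_J]

/-- The Riemannian structure on the tangent bundle given by a Hermitian metric. -/
@[reducible] def HermitianMetric.riemannianBundle (g : HermitianMetric E X) :
    RiemannianBundle (fun x : X ↦ TangentSpace 𝓘(ℝ, E) x) :=
  ⟨g.toContMDiffRiemannianMetric.toRiemannianMetric⟩

/-- The squared length of tangent vectors is a continuous function on the tangent bundle. -/
theorem continuous_inner_self (g : HermitianMetric E X) :
    Continuous fun p : TangentBundle 𝓘(ℝ, E) X ↦ g.inner p.1 p.2 p.2 := by
  let := g.riemannianBundle
  have : IsContinuousRiemannianBundle E (fun x : X ↦ TangentSpace 𝓘(ℝ, E) x) :=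
    ⟨⟨g.inner, g.contMDiff.continuous, fun b v w ↦ rfl⟩⟩
  exact Continuous.inner_bundle (F := E) (E := fun x : X ↦ TangentSpace 𝓘(ℝ, E) x)
    (b := fun p : TangentBundle 𝓘(ℝ, E) X ↦ p.1) (v := fun p ↦ p.2) (w := fun p ↦ p.2)
    continuous_id continuous_id

/-- The derivative of a curve with `|df| ≤ 1` at `z` has norm at most `2` there. (The norm is in
fact `|df| (z)`, but this cruder bound, which avoids `g (u, J u) = 0`, is enough.) -/
theorem norm_mfderiv_le (g : HermitianMetric E X) {f : ℂ → X}
    (hf : MDifferentiable 𝓘(ℂ, ℂ) 𝓘(ℂ, E) f) {z : ℂ} (h1 : sphericalDeriv g f z ≤ 1) (v : ℂ) :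
    letI := g.riemannianBundle
    ‖mfderiv 𝓘(ℝ, ℂ) 𝓘(ℝ, E) f z v‖ₑ ≤ 2 * ‖v‖ₑ := by
  let := g.riemannianBundle
  set a := mfderiv 𝓘(ℝ, ℂ) 𝓘(ℝ, E) f z (1 : ℂ) with ha
  have key : ∀ w : TangentSpace 𝓘(ℝ, E) (f z), g.inner (f z) w w = ‖w‖ ^ 2 := fun w ↦
    real_inner_self_eq_norm_sq w
  have hna : ‖a‖ ≤ 1 := by
    have : ‖a‖ ^ 2 ≤ 1 := by
      rw [← key, ha, ← pullbackDensity_eq g hf]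
      unfold sphericalDeriv at h1
      simpa using (Real.sqrt_le_iff.1 h1).2
    nlinarith [norm_nonneg a]
  have hnJ : ‖J (f z) a‖ ≤ 1 := by
    have h : ‖J (f z) a‖ ^ 2 = ‖a‖ ^ 2 := by rw [← key, ← key, g.inner_J]
    rw [(pow_left_inj₀ (norm_nonneg _) (norm_nonneg _) two_ne_zero).1 h]
    exact hna
  have hv : mfderiv 𝓘(ℝ, ℂ) 𝓘(ℝ, E) f z v = v.re • a + v.im • J (f z) a := by
    rw [ha, ← mfderiv_I hf]
    have hh : v = v.re • (1 : ℂ) + v.im • Complex.I := by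
      apply Complex.ext <;> simp
    conv_lhs => rw [hh]
    exact (map_add (mfderiv 𝓘(ℝ, ℂ) 𝓘(ℝ, E) f z) _ _).trans
      (congrArg₂ _ (map_smul (mfderiv 𝓘(ℝ, ℂ) 𝓘(ℝ, E) f z) _ _)
        (map_smul (mfderiv 𝓘(ℝ, ℂ) 𝓘(ℝ, E) f z) _ _))
  have : ‖mfderiv 𝓘(ℝ, ℂ) 𝓘(ℝ, E) f z v‖ ≤ 2 * ‖v‖ := by
    rw [hv]
    refine (norm_add_le _ _).trans ?_
    rw [norm_smul, norm_smul]
    have h3 := Complex.abs_re_le_norm v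
    have h4 := Complex.abs_im_le_norm v
    simp only [Real.norm_eq_abs]
    nlinarith [norm_nonneg a, norm_nonneg (J (f z) a), abs_nonneg v.re, abs_nonneg v.im]
  rw [← ofReal_norm, ← ofReal_norm, ← ENNReal.ofReal_ofNat, ← ENNReal.ofReal_mul (by norm_num)]
  exact ENNReal.ofReal_le_ofReal this

end Geometry

/-! ### Compactness of the space of Brody curves -/

section Compactness

open Bundle

variable {E : Type*} [NormedAddCommGroup E] [NormedSpace ℂ E]
  {X : Type*} [TopologicalSpace X] [ChartedSpace E X]

variable [IsManifold 𝓘(ℂ, E) ω X]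

theorem differentiableAt_chart_comp {f : ℂ → X} (hf : MDifferentiable 𝓘(ℂ, ℂ) 𝓘(ℂ, E) f)
    {x : X} {z : ℂ} (hz : f z ∈ (chartAt E x).source) :
    DifferentiableAt ℂ (chartAt E x ∘ f) z := by
  have h1 : MDifferentiableAt 𝓘(ℂ, E) 𝓘(ℂ, E) (extChartAt 𝓘(ℂ, E) x) (f z) :=
    mdifferentiableAt_extChartAt hz
  have h2 := (h1.comp z (hf z)).differentiableAt
  simpa using h2

theorem contMDiff_real [CompleteSpace E] {f : ℂ → X} (hf : MDifferentiable 𝓘(ℂ, ℂ) 𝓘(ℂ, E) f) :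
    ContMDiff 𝓘(ℝ, ℂ) 𝓘(ℝ, E) 1 f := by
  intro z
  refine contMDiffAt_iff.2 ⟨(hf z).continuousAt, ?_⟩
  have hopen : IsOpen (f ⁻¹' (chartAt E (f z)).source) :=
    (chartAt E (f z)).open_source.preimage hf.continuous
  have hd : DifferentiableOn ℂ (chartAt E (f z) ∘ f) (f ⁻¹' (chartAt E (f z)).source) :=
    fun w hw ↦ (differentiableAt_chart_comp hf hw).differentiableWithinAt
  have h3 : ContDiffAt ℂ 1 (chartAt E (f z) ∘ f) z :=
    (hd.contDiffOn hopen).contDiffAt (hopen.mem_nhds (mem_chart_source E (f z)))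
  exact (h3.restrict_scalars ℝ).contDiffWithinAt

theorem riemannianEDist_le [CompleteSpace E] (g : HermitianMetric E X) {f : ℂ → X}
    (hf : MDifferentiable 𝓘(ℂ, ℂ) 𝓘(ℂ, E) f) (h1 : ∀ z, sphericalDeriv g f z ≤ 1) (z w : ℂ) :
    letI := g.riemannianBundle
    Manifold.riemannianEDist 𝓘(ℝ, E) (f z) (f w) ≤ 2 * edist z w := by
  let := g.riemannianBundle
  set γ : ℝ → ℂ := fun t ↦ z + t • (w - z) with hγ
  have hγd : ∀ t, HasFDerivAt γ (ContinuousLinearMap.toSpanSingleton ℝ (w - z)) t := by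
    intro t
    have := ((hasDerivAt_id t).smul_const (w - z)).const_add z
    rw [one_smul] at this
    exact this.hasFDerivAt
  have hγc : ContDiff ℝ 1 γ := by fun_prop
  have hc : ContMDiff 𝓘(ℝ, ℝ) 𝓘(ℝ, E) 1 (f ∘ γ) := (contMDiff_real hf).comp hγc.contMDiff
  refine (Manifold.riemannianEDist_le_pathELength (γ := f ∘ γ) hc.contMDiffOn (a := 0) (b := 1)
    (by simp [hγ]) (by simp [hγ]) zero_le_one).trans ?_
  rw [Manifold.pathELength_eq_lintegral_mfderiv_Icc]
  calc _ ≤ ∫⁻ t in Icc (0 : ℝ) 1, 2 * edist z w := by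
        refine lintegral_mono fun t ↦ ?_
        have h2 := HasMFDerivAt.comp t (mdifferentiable_real hf (γ t)).hasMFDerivAt
          (hγd t).hasMFDerivAt
        rw [h2.mfderiv]
        have h3 := norm_mfderiv_le g hf (h1 (γ t)) (w - z)
        rw [edist_comm, edist_eq_enorm_sub]
        refine le_trans (le_of_eq ?_) h3
        change ‖mfderiv 𝓘(ℝ, ℂ) 𝓘(ℝ, E) f (γ t) ((1 : ℝ) • (w - z) : ℂ)‖ₑ = _
        rw [one_smul]
    _ = 2 * edist z w := by simp

/-- The Riemannian distance of a Hermitian metric. Its topology is definitionally the given topology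
of the manifold. -/
@[reducible] def HermitianMetric.emetricSpace [T3Space X] (g : HermitianMetric E X) :
    EMetricSpace X :=
  letI := g.riemannianBundle
  haveI : IsContinuousRiemannianBundle E (fun x : X ↦ TangentSpace 𝓘(ℝ, E) x) :=
    ⟨⟨g.inner, g.contMDiff.continuous, fun _ _ _ ↦ rfl⟩⟩
  .ofRiemannianMetric 𝓘(ℝ, E) X

theorem edist_le [CompleteSpace E] [T3Space X] (g : HermitianMetric E X) {f : ℂ → X}
    (hf : MDifferentiable 𝓘(ℂ, ℂ) 𝓘(ℂ, E) f) (h1 : ∀ z, sphericalDeriv g f z ≤ 1) (z w : ℂ) :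
    g.emetricSpace.edist (f z) (f w) ≤ 2 * edist z w :=
  riemannianEDist_le g hf h1 z w

/-- Arzelà–Ascoli for the `2`-Lipschitz maps from `ℂ` to a compact space. -/
theorem isCompact_lipschitz {Y : Type*} [EMetricSpace Y] [CompactSpace Y] :
    IsCompact {f : C(ℂ, Y) | ∀ z w, edist (f z) (f w) ≤ 2 * edist z w} := by
  apply ArzelaAscoli.isCompact_of_equicontinuous
  · have : ContinuousMap.toFun '' {f : C(ℂ, Y) | ∀ z w, edist (f z) (f w) ≤ 2 * edist z w} =
        {f : ℂ → Y | ∀ z w, edist (f z) (f w) ≤ 2 * edist z w} := by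
      ext f
      constructor
      · rintro ⟨F, hF, rfl⟩
        exact hF
      · intro hf
        have hl : LipschitzWith 2 f := fun z w ↦ by simpa using hf z w
        exact ⟨⟨f, hl.continuous⟩, hf, rfl⟩
    rw [this]
    refine IsClosed.isCompact ?_
    simp only [ofPred_forall]
    refine isClosed_iInter fun z ↦ isClosed_iInter fun w ↦ ?_
    exact isClosed_le ((continuous_apply z).edist (continuous_apply w)) continuous_const
  · refine UniformEquicontinuous.equicontinuous (LipschitzWith.uniformEquicontinuous _ 2 ?_)
    intro f z w
    simpa using f.2 z w

omit [NormedSpace ℂ E] [IsManifold 𝓘(ℂ, E) ω X] in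
theorem tendstoLocallyUniformlyOn_chart_comp (f : C(ℂ, X)) (S : Set C(ℂ, X)) (x : X) :
    TendstoLocallyUniformlyOn (fun (h : C(ℂ, X)) ↦ chartAt E x ∘ h)
      (chartAt E x ∘ f) (𝓝[S] f) (f ⁻¹' (chartAt E x).source) := by
  rw [tendstoLocallyUniformlyOn_iff_forall_tendsto]
  intro z hz
  have he : ContinuousAt (chartAt E x) (f z) := (chartAt E x).continuousAt hz
  have h1 : Tendsto (fun p : C(ℂ, X) × ℂ ↦ chartAt E x (p.1 p.2))
      (𝓝[S] f ×ˢ 𝓝[f ⁻¹' (chartAt E x).source] z) (𝓝 (chartAt E x (f z))) := by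
    have h2 : ContinuousAt (fun p : C(ℂ, X) × ℂ ↦ p.1 p.2) (f, z) :=
      ContinuousEval.continuous_eval.continuousAt
    refine Tendsto.comp (f := fun p : C(ℂ, X) × ℂ ↦ p.1 p.2) he (h2.mono_left ?_)
    rw [nhds_prod_eq]
    exact Filter.prod_mono nhdsWithin_le_nhds nhdsWithin_le_nhds
  have h3 : Tendsto (fun p : C(ℂ, X) × ℂ ↦ chartAt E x (f p.2))
      (𝓝[S] f ×ˢ 𝓝[f ⁻¹' (chartAt E x).source] z) (𝓝 (chartAt E x (f z))) :=
    (Tendsto.comp (f := f) he (f.continuous.continuousAt.mono_left nhdsWithin_le_nhds)).comp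
      tendsto_snd
  exact (h3.prodMk_nhds h1).mono_right (nhds_le_uniformity _)

/-- Near a point whose image under `f` lies in the domain of a chart, all holomorphic curves close
to `f` can be read in this chart, on a common neighbourhood. -/
theorem exists_isOpen_differentiableOn {S : Set C(ℂ, X)}
    (hS : ∀ h ∈ S, MDifferentiable 𝓘(ℂ, ℂ) 𝓘(ℂ, E) h) (f : C(ℂ, X)) {x : X} {z : ℂ}
    (hz : f z ∈ (chartAt E x).source) :
    ∃ U : Set ℂ, IsOpen U ∧ z ∈ U ∧ U ⊆ f ⁻¹' (chartAt E x).source ∧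
      ∀ᶠ h : C(ℂ, X) in 𝓝[S] f, h z ∈ (chartAt E x).source ∧
        DifferentiableOn ℂ (chartAt E x ∘ h) U := by
  have hopen : IsOpen (f ⁻¹' (chartAt E x).source) :=
    (chartAt E x).open_source.preimage f.continuous
  obtain ⟨r, hr, hsub⟩ := Metric.nhds_basis_closedBall.mem_iff.1 (hopen.mem_nhds hz)
  refine ⟨Metric.ball z r, Metric.isOpen_ball, Metric.mem_ball_self hr,
    Metric.ball_subset_closedBall.trans hsub, ?_⟩
  have h1 : ∀ᶠ h : C(ℂ, X) in 𝓝[S] f, MapsTo h (Metric.closedBall z r) (chartAt E x).source :=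
    nhdsWithin_le_nhds (ContinuousMap.eventually_mapsTo (isCompact_closedBall z r)
      (chartAt E x).open_source hsub)
  filter_upwards [h1, self_mem_nhdsWithin] with h hm hh
  exact ⟨hm (Metric.mem_closedBall_self hr.le), fun w hw ↦ (differentiableAt_chart_comp (hS h hh)
    (hm (Metric.ball_subset_closedBall hw))).differentiableWithinAt⟩

/-- Weierstrass' theorem: limits of holomorphic curves in the compact-open topology are
holomorphic. -/
theorem mdifferentiable_of_mem_closure [CompleteSpace E] {S : Set C(ℂ, X)}
    (hS : ∀ h ∈ S, MDifferentiable 𝓘(ℂ, ℂ) 𝓘(ℂ, E) h) {f : C(ℂ, X)} (hf : f ∈ closure S) :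
    MDifferentiable 𝓘(ℂ, ℂ) 𝓘(ℂ, E) f := by
  intro z
  have : (𝓝[S] f).NeBot := mem_closure_iff_nhdsWithin_neBot.1 hf
  obtain ⟨U, hU, hzU, hUs, hev⟩ := exists_isOpen_differentiableOn hS f (mem_chart_source E (f z))
  have hd := ((tendstoLocallyUniformlyOn_chart_comp f S (f z)).mono hUs).differentiableOn
    (hev.mono fun h hh ↦ hh.2) hU
  refine mdifferentiableAt_iff _ _ |>.2 ⟨f.continuous.continuousAt, ?_⟩
  exact (hd.differentiableAt (hU.mem_nhds hzU)).differentiableWithinAt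

/-- In the trivialization of the tangent bundle given by a chart, the vector `∂f/∂x` is the complex
derivative of `f` read in this chart. -/
theorem trivialization_mfderiv {f : ℂ → X} (hf : MDifferentiable 𝓘(ℂ, ℂ) 𝓘(ℂ, E) f)
    {x : X} {z : ℂ} (hz : f z ∈ (chartAt E x).source) :
    (trivializationAt E (TangentSpace 𝓘(ℝ, E)) x
      (⟨f z, mfderiv 𝓘(ℝ, ℂ) 𝓘(ℝ, E) f z (1 : ℂ)⟩ : TangentBundle 𝓘(ℝ, E) X)).2 =
      deriv (chartAt E x ∘ f) z := by
  have h1 : MDifferentiableAt 𝓘(ℝ, E) 𝓘(ℝ, E) (extChartAt 𝓘(ℝ, E) x) (f z) :=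
    mdifferentiableAt_extChartAt hz
  have h2 := (HasMFDerivAt.comp z h1.hasMFDerivAt
    (mdifferentiable_real hf z).hasMFDerivAt).hasFDerivAt
  have h3 := (differentiableAt_chart_comp hf hz).hasFDerivAt.restrictScalars ℝ
  have h4 : HasFDerivAt (𝕜 := ℝ) (E := ℂ) (F := E) (chartAt E x ∘ f)
      (show ℂ →L[ℝ] E from mfderiv 𝓘(ℝ, E) 𝓘(ℝ, E) (extChartAt 𝓘(ℝ, E) x) (f z) ∘L
        mfderiv 𝓘(ℝ, ℂ) 𝓘(ℝ, E) f z) z := h2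
  have h5 := congrArg (fun L : ℂ →L[ℝ] E ↦ L 1) (h4.unique h3)
  have h6 := TangentBundle.continuousLinearMapAt_trivializationAt (𝕜 := ℝ) (I := 𝓘(ℝ, E)) hz
  have h7 : deriv (chartAt E x ∘ f) z = fderiv ℂ (chartAt E x ∘ f) z 1 := rfl
  rw [h7]
  refine Eq.trans ?_ h5
  have h8 := DFunLike.congr_fun h6 (mfderiv 𝓘(ℝ, ℂ) 𝓘(ℝ, E) f z (1 : ℂ))
  refine Eq.trans ?_ h8
  rw [Bundle.Trivialization.continuousLinearMapAt_apply, Bundle.Trivialization.linearMapAt_apply,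
    if_pos (by simpa using hz)]

/-- The spherical derivative depends continuously on the curve, because the velocity vectors
`∂f/∂x` converge in the tangent bundle, by Weierstrass' theorem for derivatives. -/
theorem tendsto_sphericalDeriv [CompleteSpace E] (g : HermitianMetric E X) {S : Set C(ℂ, X)}
    (hS : ∀ h ∈ S, MDifferentiable 𝓘(ℂ, ℂ) 𝓘(ℂ, E) h) {f : C(ℂ, X)}
    (hf : MDifferentiable 𝓘(ℂ, ℂ) 𝓘(ℂ, E) f) (z : ℂ) :
    Tendsto (fun h : C(ℂ, X) ↦ sphericalDeriv g h z) (𝓝[S] f) (𝓝 (sphericalDeriv g f z)) := by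
  refine (Real.continuous_sqrt.tendsto _).comp ?_
  have hz := mem_chart_source E (f z)
  obtain ⟨U, hU, hzU, hUs, hev⟩ := exists_isOpen_differentiableOn hS f hz
  let T : C(ℂ, X) → TangentBundle 𝓘(ℝ, E) X := fun h ↦
    ⟨h z, mfderiv 𝓘(ℝ, ℂ) 𝓘(ℝ, E) h z (1 : ℂ)⟩
  have hT : Tendsto T (𝓝[S] f) (𝓝 (T f)) := by
    rw [(trivializationAt E (TangentSpace 𝓘(ℝ, E)) (f z)).tendsto_nhds_iff
      (FiberBundle.mem_trivializationAt_proj_source (x := T f))]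
    refine ⟨(ContinuousEvalConst.continuous_eval_const z).continuousAt.mono_left
      nhdsWithin_le_nhds, ?_⟩
    have hd := (((tendstoLocallyUniformlyOn_chart_comp f S (f z)).mono hUs).deriv
      (hev.mono fun h hh ↦ hh.2) hU).tendsto_at hzU
    rw [trivialization_mfderiv hf hz]
    refine hd.congr' ?_
    filter_upwards [hev, self_mem_nhdsWithin] with h h1 h2
    exact (trivialization_mfderiv (hS h h2) h1.1).symm
  have hlim := ((continuous_inner_self g).tendsto (T f)).comp hT
  rw [pullbackDensity_eq g hf]
  refine hlim.congr' ?_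
  filter_upwards [self_mem_nhdsWithin] with h hh
  exact (pullbackDensity_eq g (hS h hh) z).symm

theorem isClosed_brodyCurves [CompleteSpace E] (g : HermitianMetric E X) :
    IsClosed (brodyCurves g) := by
  refine isClosed_of_closure_subset fun f hf ↦ ?_
  have hS : ∀ h ∈ brodyCurves g, MDifferentiable 𝓘(ℂ, ℂ) 𝓘(ℂ, E) h := fun h hh ↦ hh.1
  have hfd := mdifferentiable_of_mem_closure hS hf
  have : (𝓝[brodyCurves g] f).NeBot := mem_closure_iff_nhdsWithin_neBot.1 hf
  refine ⟨hfd, fun z ↦ le_of_tendsto (tendsto_sphericalDeriv g hS hfd z) ?_⟩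
  filter_upwards [self_mem_nhdsWithin] with h hh using hh.2 z

theorem isCompact_brodyCurves [CompleteSpace E] [T2Space X] [CompactSpace X]
    (g : HermitianMetric E X) : IsCompact (brodyCurves g) := by
  let := g.emetricSpace
  exact isCompact_lipschitz.of_isClosed_subset (isClosed_brodyCurves g)
    fun f hf ↦ edist_le g hf.1 hf.2

theorem seqCompactSpace_brodyCurves [CompleteSpace E] [T2Space X] [CompactSpace X]
    (g : HermitianMetric E X) : SeqCompactSpace (brodyCurves g) := by
  have : CompactSpace (brodyCurves g) := isCompact_iff_compactSpace.1 (isCompact_brodyCurves g)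
  let := g.emetricSpace
  infer_instance

theorem firstCountableTopology_brodyCurves [CompleteSpace E] [T2Space X] [CompactSpace X]
    (g : HermitianMetric E X) : FirstCountableTopology (brodyCurves g) := by
  let := g.emetricSpace
  infer_instance

theorem continuous_sphericalDeriv [CompleteSpace E] (g : HermitianMetric E X) (z : ℂ) :
    Continuous fun h : brodyCurves g ↦ sphericalDeriv g h.1 z := by
  refine continuous_iff_continuousAt.2 fun f ↦ ?_
  refine (tendsto_sphericalDeriv g (S := brodyCurves g) (fun h hh ↦ hh.1) f.2.1 z).comp ?_
  exact tendsto_nhdsWithin_iff.2 ⟨continuous_subtype_val.continuousAt,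
    Eventually.of_forall fun h ↦ h.2⟩

theorem sphericalDeriv_vadd (g : HermitianMetric E X) (f : brodyCurves g) (a z : ℂ) :
    sphericalDeriv g (a +ᵥ f).1 z = sphericalDeriv g f.1 (z + a) :=
  sphericalDeriv_translate g f.2.1 a z

theorem continuous_vadd_left (g : HermitianMetric E X) (f : brodyCurves g) :
    Continuous fun a : ℂ ↦ a +ᵥ f := by
  refine Continuous.subtype_mk (f := fun a : ℂ ↦ (a +ᵥ f).1) ?_ _
  refine ContinuousMap.continuous_of_continuous_uncurry _ ?_
  exact f.1.continuous.comp (continuous_snd.add continuous_fst)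

theorem continuous_vadd_right (g : HermitianMetric E X) (a : ℂ) :
    Continuous fun f : brodyCurves g ↦ a +ᵥ f := by
  refine Continuous.subtype_mk (f := fun f : brodyCurves g ↦ (a +ᵥ f).1) ?_ _
  exact (ContinuousMap.continuous_precomp ⟨fun z : ℂ ↦ z + a, by fun_prop⟩).comp
    continuous_subtype_val

/-- Continuity in the point follows from continuity in the curve, as moving the point amounts to
translating the curve. -/
theorem continuous_sphericalDeriv_apply [CompleteSpace E] (g : HermitianMetric E X)
    (f : brodyCurves g) : Continuous (sphericalDeriv g f.1) := by
  have := (continuous_sphericalDeriv g 0).comp (continuous_vadd_left g f)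
  refine this.congr fun a ↦ ?_
  simp only [Function.comp_apply, sphericalDeriv_vadd, zero_add]

end Compactness

/-! ### Averages of a density over discs -/

section Mass

/-- The mass of the density `φ` on the disc of radius `R` about `a`. -/
def ballMass (φ : ℂ → ℝ≥0∞) (a : ℂ) (R : ℝ) : ℝ≥0∞ :=
  ∫⁻ z in Metric.ball a R, φ z

/-- The supremum of the averages of `φ` over the discs of radius `R`. -/
def meanMass (φ : ℂ → ℝ≥0∞) (R : ℝ) : ℝ≥0∞ :=
  ENNReal.ofReal (1 / (Real.pi * R ^ 2)) * ⨆ a : ℂ, ballMass φ a R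

/-- The integral `∫_0^R (∫_{|z - a| < t} φ) dt / t`, that is, the Nevanlinna–Shimizu–Ahlfors
characteristic centred at `a` and with the integration starting at `0`. -/
def logMass (φ : ℂ → ℝ≥0∞) (a : ℂ) (R : ℝ) : ℝ≥0∞ :=
  ∫⁻ t in Ioc 0 R, ballMass φ a t / ENNReal.ofReal t

variable {φ : ℂ → ℝ≥0∞}

theorem volume_ball_eq (a : ℂ) {R : ℝ} (hR : 0 ≤ R) :
    volume (Metric.ball a R) = ENNReal.ofReal (Real.pi * R ^ 2) := by
  rw [Complex.volume_ball, ← ENNReal.ofReal_coe_nnreal, ← ENNReal.ofReal_pow hR,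
    ← ENNReal.ofReal_mul (by positivity), mul_comm]
  rfl

theorem ballMass_le (hφ1 : ∀ z, φ z ≤ 1) (a : ℂ) {R : ℝ} (hR : 0 ≤ R) :
    ballMass φ a R ≤ ENNReal.ofReal (Real.pi * R ^ 2) := by
  rw [← volume_ball_eq a hR]
  refine (lintegral_mono fun z ↦ hφ1 z).trans ?_
  simp

theorem measurable_ballMass (hφ : Measurable φ) :
    Measurable fun p : ℂ × ℝ ↦ ballMass φ p.1 p.2 := by
  have hs : MeasurableSet {q : (ℂ × ℝ) × ℂ | dist q.2 q.1.1 < q.1.2} :=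
    (isOpen_lt (by fun_prop) (by fun_prop)).measurableSet
  have : ∀ p : ℂ × ℝ, ballMass φ p.1 p.2 =
      ∫⁻ z, {q : (ℂ × ℝ) × ℂ | dist q.2 q.1.1 < q.1.2}.indicator (fun q ↦ φ q.2) (p, z) := by
    intro p
    unfold ballMass
    rw [← lintegral_indicator measurableSet_ball]
    rfl
  simp_rw [this]
  exact ((hφ.comp measurable_snd).indicator hs).lintegral_prod_right'

/-- The masses of the discs of radius `r` centred in a disc of radius at least `L + r` integrate to
at least `π r²` times the mass of the concentric disc of radius `L`, all of whose points are
covered fully. -/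
theorem volume_mul_ballMass_le (hφ : Measurable φ) (b : ℂ) {L r s : ℝ} (hs : L + r ≤ s) :
    volume (Metric.ball (0 : ℂ) r) * ballMass φ b L ≤
      ∫⁻ a in Metric.ball b s, ballMass φ a r := by
  have hm : MeasurableSet {q : ℂ × ℂ | dist q.2 q.1 < r} :=
    (isOpen_lt (by fun_prop) (by fun_prop)).measurableSet
  have h1 : ∀ a, ballMass φ a r =
      ∫⁻ z, {q : ℂ × ℂ | dist q.2 q.1 < r}.indicator (fun q ↦ φ q.2) (a, z) := by
    intro a
    unfold ballMass
    rw [← lintegral_indicator measurableSet_ball]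
    rfl
  simp_rw [h1]
  rw [lintegral_lintegral_swap (f := fun a z ↦ {q : ℂ × ℂ | dist q.2 q.1 < r}.indicator
      (fun q ↦ φ q.2) (a, z)) ((hφ.comp measurable_snd).indicator hm).aemeasurable, ballMass,
    ← lintegral_const_mul _ hφ]
  refine le_trans ?_ (setLIntegral_le_lintegral (Metric.ball b L) _)
  refine setLIntegral_mono' measurableSet_ball fun z hz ↦ ?_
  have h2 : (fun a ↦ {q : ℂ × ℂ | dist q.2 q.1 < r}.indicator (fun q ↦ φ q.2) (a, z)) =
      (Metric.ball z r).indicator fun _ ↦ φ z := by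
    ext a
    simp [indicator, dist_comm]
  rw [h2, setLIntegral_indicator measurableSet_ball, setLIntegral_const, mul_comm]
  refine mul_le_mul_right ?_ _
  rw [inter_eq_left.2 (Metric.ball_subset_ball' (by rw [Metric.mem_ball] at hz; linarith))]
  exact (Measure.addHaar_ball_center volume z r).ge

theorem meanMass_le_one (hφ1 : ∀ z, φ z ≤ 1) {R : ℝ} (hR : 0 < R) : meanMass φ R ≤ 1 := by
  refine (mul_le_mul_right (iSup_le fun a ↦ ballMass_le hφ1 a hR.le) _).trans ?_
  rw [← ENNReal.ofReal_mul (by positivity), one_div_mul_cancel (by positivity), ENNReal.ofReal_one]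

theorem iSup_ballMass_eq (φ : ℂ → ℝ≥0∞) {R : ℝ} (hR : 0 < R) :
    ⨆ a, ballMass φ a R = ENNReal.ofReal (Real.pi * R ^ 2) * meanMass φ R := by
  rw [meanMass, ← mul_assoc, ← ENNReal.ofReal_mul (by positivity), mul_one_div_cancel
    (by positivity), ENNReal.ofReal_one, one_mul]

theorem ballMass_le_meanMass (φ : ℂ → ℝ≥0∞) (a : ℂ) {R : ℝ} (hR : 0 < R) :
    ballMass φ a R ≤ ENNReal.ofReal (Real.pi * R ^ 2) * meanMass φ R := by
  rw [← iSup_ballMass_eq φ hR]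
  exact le_iSup (fun a ↦ ballMass φ a R) a

theorem meanMass_le (hφ : Measurable φ) {L r : ℝ} (hL : 0 < L) (hr : 0 < r) :
    meanMass φ L ≤ ENNReal.ofReal ((1 + r / L) ^ 2) * meanMass φ r := by
  have h0 : ENNReal.ofReal (Real.pi * r ^ 2) * ⨆ b, ballMass φ b L ≤
      ENNReal.ofReal (Real.pi * (L + r) ^ 2) *
        (ENNReal.ofReal (Real.pi * r ^ 2) * meanMass φ r) := by
    rw [ENNReal.mul_iSup]
    refine iSup_le fun b ↦ ?_
    rw [← volume_ball_eq 0 hr.le]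
    refine (volume_mul_ballMass_le hφ b le_rfl).trans ?_
    refine (lintegral_mono fun a ↦ ballMass_le_meanMass φ a hr).trans ?_
    rw [setLIntegral_const, volume_ball_eq b (by positivity), volume_ball_eq 0 hr.le, mul_comm]
  rw [iSup_ballMass_eq φ hL, mul_left_comm (ENNReal.ofReal (Real.pi * (L + r) ^ 2)),
    ENNReal.mul_le_mul_iff_right (by positivity) ENNReal.ofReal_ne_top] at h0
  have h1 : ENNReal.ofReal ((1 + r / L) ^ 2) =
      ENNReal.ofReal (1 / (Real.pi * L ^ 2)) * ENNReal.ofReal (Real.pi * (L + r) ^ 2) := by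
    rw [← ENNReal.ofReal_mul (by positivity)]
    congr 1
    field_simp
  rw [h1, mul_assoc]
  refine le_trans (le_of_eq ?_) (mul_le_mul_right h0 _)
  rw [← mul_assoc, ← ENNReal.ofReal_mul (by positivity), one_div_mul_cancel (by positivity),
    ENNReal.ofReal_one, one_mul]

theorem tendsto_one_add_div_sq (r : ℝ) :
    Tendsto (fun L : ℝ ↦ ENNReal.ofReal ((1 + r / L) ^ 2)) atTop (𝓝 1) := by
  have h := (((tendsto_const_nhds (x := r)).div_atTop tendsto_id).const_add 1).pow 2
  simpa using ENNReal.tendsto_ofReal h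

/-- The asymptotic density of `φ`, defined as an infimum of mean masses; it is also their limit
(`tendsto_meanMass`). -/
def massDensity (φ : ℂ → ℝ≥0∞) : ℝ≥0∞ :=
  ⨅ r : {r : ℝ // 0 < r}, meanMass φ r

theorem massDensity_le (φ : ℂ → ℝ≥0∞) {r : ℝ} (hr : 0 < r) : massDensity φ ≤ meanMass φ r :=
  iInf_le (fun r : {r : ℝ // 0 < r} ↦ meanMass φ r) ⟨r, hr⟩

theorem massDensity_le_one (hφ1 : ∀ z, φ z ≤ 1) : massDensity φ ≤ 1 :=
  (massDensity_le φ one_pos).trans (meanMass_le_one hφ1 one_pos)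

theorem tendsto_meanMass (hφ : Measurable φ) :
    Tendsto (meanMass φ) atTop (𝓝 (massDensity φ)) := by
  refine tendsto_of_le_liminf_of_limsup_le ?_ ?_
  · refine le_liminf_of_le (by isBoundedDefault) ?_
    filter_upwards [eventually_gt_atTop 0] with L hL using massDensity_le φ hL
  · refine le_iInf fun ⟨r, hr⟩ ↦ ?_
    have h1 : Tendsto (fun L : ℝ ↦ ENNReal.ofReal ((1 + r / L) ^ 2) * meanMass φ r) atTop
        (𝓝 (meanMass φ r)) := by
      have := ENNReal.Tendsto.mul_const (tendsto_one_add_div_sq r)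
        (Or.inl one_ne_zero) (b := meanMass φ r)
      simpa using this
    rw [← h1.limsup_eq]
    refine limsup_le_limsup ?_
    filter_upwards [eventually_gt_atTop 0] with L hL using meanMass_le hφ hL hr

theorem lintegral_Ioc_mul_ofReal {c : ℝ≥0∞} {R : ℝ} (hR : 0 ≤ R) :
    ∫⁻ t in Ioc 0 R, c * ENNReal.ofReal t = c * ENNReal.ofReal (R ^ 2 / 2) := by
  rw [lintegral_const_mul _ (by fun_prop), ← ofReal_integral_eq_lintegral_ofReal,
    ← intervalIntegral.integral_of_le hR]
  · simp
  · exact (continuous_id.integrableOn_Icc).mono_set Ioc_subset_Icc_self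
  · filter_upwards [ae_restrict_mem measurableSet_Ioc] with t ht using ht.1.le

theorem ofReal_mul_sq_div {t : ℝ} (ht : 0 < t) {c : ℝ} (hc : 0 ≤ c) :
    ENNReal.ofReal (c * t ^ 2) / ENNReal.ofReal t = ENNReal.ofReal c * ENNReal.ofReal t := by
  rw [← ENNReal.ofReal_div_of_pos ht, ← ENNReal.ofReal_mul hc]
  congr 1
  field_simp

/-- At every scale `R` there are centres for which the logarithmic integral is almost as large as
for the constant density `massDensity φ`: average over the centres in a large disc. -/
theorem massDensity_mul_le_iSup_logMass (hφ : Measurable φ) {R : ℝ} (hR : 0 < R) :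
    massDensity φ * ENNReal.ofReal (Real.pi * R ^ 2 / 2) ≤ ⨆ a, logMass φ a R := by
  set S := ⨆ a, logMass φ a R
  have key : ∀ L > 0, massDensity φ * ENNReal.ofReal (Real.pi * R ^ 2 / 2) ≤
      ENNReal.ofReal ((1 + R / L) ^ 2) * S := by
    intro L hL
    have h1 : ∀ b, ENNReal.ofReal (Real.pi * R ^ 2 / 2) * ballMass φ b L ≤
        ENNReal.ofReal (Real.pi * (L + R) ^ 2) * S := by
      intro b
      have h2 : ∫⁻ a in Metric.ball b (L + R), logMass φ a R ≤
          ENNReal.ofReal (Real.pi * (L + R) ^ 2) * S := by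
        refine (lintegral_mono fun a ↦ le_iSup (fun a ↦ logMass φ a R) a).trans ?_
        rw [setLIntegral_const, volume_ball_eq b (by positivity), mul_comm]
      refine le_trans ?_ h2
      unfold logMass
      have hmeas : Measurable fun p : ℂ × ℝ ↦ ballMass φ p.1 p.2 / ENNReal.ofReal p.2 :=
        (measurable_ballMass hφ).div (by fun_prop)
      rw [lintegral_lintegral_swap hmeas.aemeasurable]
      have h3 : ENNReal.ofReal (Real.pi * R ^ 2 / 2) * ballMass φ b L =
          ∫⁻ t in Ioc 0 R, (ballMass φ b L * ENNReal.ofReal Real.pi) * ENNReal.ofReal t := by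
        rw [lintegral_Ioc_mul_ofReal hR.le, mul_assoc, ← ENNReal.ofReal_mul Real.pi_pos.le,
          mul_comm, mul_div_assoc]
      rw [h3]
      refine setLIntegral_mono' measurableSet_Ioc fun t ht ↦ ?_
      have h4 : ∀ a, ballMass φ a t / ENNReal.ofReal t =
          (ENNReal.ofReal t)⁻¹ * ballMass φ a t := fun a ↦ by rw [mul_comm]; rfl
      simp_rw [h4]
      have h6 : Measurable fun a ↦ ballMass φ a t :=
        (measurable_ballMass hφ).comp (measurable_id.prodMk measurable_const)
      rw [lintegral_const_mul _ h6]
      refine le_trans (le_of_eq ?_) (mul_le_mul_right (volume_mul_ballMass_le hφ b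
        (show L + t ≤ L + R by linarith [ht.2])) _)
      rw [volume_ball_eq 0 ht.1.le, ← mul_assoc, mul_comm (ENNReal.ofReal t)⁻¹, ← div_eq_mul_inv,
        ofReal_mul_sq_div ht.1 Real.pi_pos.le]
      ring
    have h5 : ENNReal.ofReal (Real.pi * L ^ 2) *
        (massDensity φ * ENNReal.ofReal (Real.pi * R ^ 2 / 2)) ≤
        ENNReal.ofReal (Real.pi * L ^ 2) * (ENNReal.ofReal ((1 + R / L) ^ 2) * S) := by
      have h7 : ENNReal.ofReal (Real.pi * L ^ 2) * (ENNReal.ofReal ((1 + R / L) ^ 2) * S) =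
          ENNReal.ofReal (Real.pi * (L + R) ^ 2) * S := by
        rw [← mul_assoc, ← ENNReal.ofReal_mul (by positivity)]
        congr 2
        field_simp
      rw [h7, ← mul_assoc, mul_comm _ (ENNReal.ofReal (Real.pi * R ^ 2 / 2))]
      refine (mul_le_mul_right (mul_le_mul_right (massDensity_le φ hL) _) _).trans ?_
      rw [← iSup_ballMass_eq φ hL, ENNReal.mul_iSup]
      exact iSup_le h1
    rwa [ENNReal.mul_le_mul_iff_right (by positivity) ENNReal.ofReal_ne_top] at h5
  have hlim := ENNReal.Tendsto.mul_const (tendsto_one_add_div_sq R) (Or.inl one_ne_zero) (b := S)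
  rw [one_mul] at hlim
  refine ge_of_tendsto hlim ?_
  filter_upwards [eventually_gt_atTop 0] with L hL using key L hL

end Mass

/-! ### The Green potential of a disc -/

section Potential
open scoped ComplexConjugate

variable {φ : ℂ → ℝ≥0∞}

theorem lintegral_indicator_div {R d : ℝ} (hR : 0 ≤ R) (hd : 0 < d) :
    ∫⁻ t in Ioc 0 R, (Ioi d).indicator (fun t ↦ ENNReal.ofReal t⁻¹) t =
      ENNReal.ofReal (Real.posLog (R / d)) := by
  rw [setLIntegral_indicator measurableSet_Ioi]
  have hset : Ioi d ∩ Ioc 0 R = Ioc d R := by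
    ext t
    simp only [mem_inter_iff, mem_Ioi, mem_Ioc]
    exact ⟨fun h ↦ ⟨h.1, h.2.2⟩, fun h ↦ ⟨h.1, hd.trans h.1, h.2⟩⟩
  rw [hset]
  rcases le_or_gt R d with h | h
  · rw [Ioc_eq_empty (not_lt.2 h), Measure.restrict_empty, lintegral_zero_measure]
    rw [(Real.posLog_eq_zero_iff _).2, ENNReal.ofReal_zero]
    rw [abs_of_nonneg (by positivity)]
    exact (div_le_one hd).2 h
  · have h1 : IntegrableOn (fun t : ℝ ↦ t⁻¹) (Ioc d R) := by
      refine (ContinuousOn.integrableOn_Icc ?_).mono_set Ioc_subset_Icc_self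
      exact continuousOn_inv₀.mono fun t ht ↦ (hd.trans_le ht.1).ne'
    rw [← ofReal_integral_eq_lintegral_ofReal h1,
      ← intervalIntegral.integral_of_le h.le, integral_inv_of_pos hd (hd.trans h),
      Real.posLog_eq_log]
    · rw [abs_of_pos (div_pos (hd.trans h) hd)]
      exact ((one_lt_div hd).2 h).le
    · filter_upwards [ae_restrict_mem measurableSet_Ioc] with t ht
      exact (inv_pos.2 (hd.trans ht.1)).le

/-- Fubini: the logarithmic integral as an integral against the kernel `log⁺ (R / |a - w|)`. The
junk value of the kernel at `w = a` is harmless. -/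
theorem logMass_eq (hφ : Measurable φ) (a : ℂ) {R : ℝ} (hR : 0 < R) :
    logMass φ a R = ∫⁻ w, φ w * ENNReal.ofReal (Real.posLog (R / ‖a - w‖)) := by
  have hm : MeasurableSet {q : ℝ × ℂ | ‖a - q.2‖ < q.1} :=
    (isOpen_lt (by fun_prop) (by fun_prop)).measurableSet
  have h1 : logMass φ a R = ∫⁻ t in Ioc 0 R, ∫⁻ w,
      {q : ℝ × ℂ | ‖a - q.2‖ < q.1}.indicator
        (fun q ↦ φ q.2 * ENNReal.ofReal q.1⁻¹) (t, w) := by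
    refine setLIntegral_congr_fun measurableSet_Ioc fun t ht ↦ ?_
    rw [div_eq_mul_inv, ← ENNReal.ofReal_inv_of_pos ht.1, ballMass, ← lintegral_mul_const _ hφ,
      ← lintegral_indicator measurableSet_ball]
    refine lintegral_congr fun w ↦ ?_
    simp only [indicator, Metric.mem_ball, dist_comm w, dist_eq_norm, mem_ofPred_eq]
  rw [h1, lintegral_lintegral_swap (f := fun t w ↦ {q : ℝ × ℂ | ‖a - q.2‖ < q.1}.indicator
        (fun q ↦ φ q.2 * ENNReal.ofReal q.1⁻¹) (t, w))
    (((hφ.comp measurable_snd).mul (by fun_prop)).indicator hm).aemeasurable]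
  refine lintegral_congr_ae ?_
  filter_upwards [compl_mem_ae_iff.2 (measure_singleton a)] with w hw
  have hd : 0 < ‖a - w‖ := norm_pos_iff.2 (sub_ne_zero.2 fun h ↦ hw h.symm)
  rw [← lintegral_indicator_div hR.le hd, ← lintegral_const_mul _
    ((measurable_inv.ennreal_ofReal).indicator measurableSet_Ioi)]
  refine lintegral_congr fun t ↦ ?_
  simp only [indicator, mem_ofPred_eq, mem_Ioi, mul_ite, mul_zero]

/-- The Green function `log |(R² - z̄ w) / (R (z - w))|` of the disc of radius `R`. As a difference
of logarithms it has a finite junk value on the diagonal. -/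
def greenDisc (R : ℝ) (z w : ℂ) : ℝ :=
  Real.log ‖(R : ℂ) ^ 2 - conj z * w‖ - Real.log R - Real.log ‖z - w‖

/-- The identity behind the positivity of the Green function and its decay at the boundary. -/
theorem norm_sq_sub_conj_mul (R : ℝ) (z w : ℂ) :
    ‖(R : ℂ) ^ 2 - conj z * w‖ ^ 2 =
      (R * ‖z - w‖) ^ 2 + (R ^ 2 - ‖z‖ ^ 2) * (R ^ 2 - ‖w‖ ^ 2) := by
  rw [mul_pow]
  rw [Complex.sq_norm, Complex.sq_norm, Complex.sq_norm, Complex.sq_norm]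
  simp only [Complex.normSq_apply, Complex.sub_re, Complex.sub_im,
    Complex.mul_re, Complex.mul_im, Complex.conj_re, Complex.conj_im, pow_two, Complex.ofReal_re,
    Complex.ofReal_im]
  ring

theorem mul_norm_sub_le {R : ℝ} (hR : 0 < R) {z w : ℂ} (hz : ‖z‖ < R) (hw : ‖w‖ < R) :
    R * ‖z - w‖ ≤ ‖(R : ℂ) ^ 2 - conj z * w‖ := by
  have h1 : 0 < (R ^ 2 - ‖z‖ ^ 2) * (R ^ 2 - ‖w‖ ^ 2) :=
    mul_pos (by nlinarith [norm_nonneg z]) (by nlinarith [norm_nonneg w])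
  refine le_of_sq_le_sq ?_ (norm_nonneg _)
  rw [norm_sq_sub_conj_mul]
  linarith

theorem norm_sq_sub_conj_mul_pos {R : ℝ} (hR : 0 < R) {z w : ℂ} (hz : ‖z‖ < R) (hw : ‖w‖ < R) :
    0 < ‖(R : ℂ) ^ 2 - conj z * w‖ := by
  have h1 : 0 < (R ^ 2 - ‖z‖ ^ 2) * (R ^ 2 - ‖w‖ ^ 2) :=
    mul_pos (by nlinarith [norm_nonneg z]) (by nlinarith [norm_nonneg w])
  have h2 := norm_sq_sub_conj_mul R z w
  have h3 : 0 < ‖(R : ℂ) ^ 2 - conj z * w‖ ^ 2 := by rw [h2]; positivity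
  exact (norm_nonneg _).lt_of_ne fun h ↦ by simp [← h] at h3

theorem greenDisc_nonneg {R : ℝ} (hR : 0 < R) {z w : ℂ} (hz : ‖z‖ < R) (hw : ‖w‖ < R)
    (hzw : z ≠ w) : 0 ≤ greenDisc R z w := by
  have hd : 0 < ‖z - w‖ := norm_pos_iff.2 (sub_ne_zero.2 hzw)
  have h := Real.log_le_log (by positivity) (mul_norm_sub_le hR hz hw)
  rw [Real.log_mul hR.ne' hd.ne'] at h
  unfold greenDisc
  linarith

/-- The bound `log (A / B) ≤ A / B - 1` together with `A ≤ B + R √(R² - |z|²)`, for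
`A = |R² - z̄ w|` and `B = R |z - w|`. -/
theorem greenDisc_le {R : ℝ} (hR : 0 < R) {z w : ℂ} (hz : ‖z‖ < R) (hw : ‖w‖ < R)
    (hzw : z ≠ w) : greenDisc R z w ≤ √(R ^ 2 - ‖z‖ ^ 2) * ‖z - w‖⁻¹ := by
  have hd : 0 < ‖z - w‖ := norm_pos_iff.2 (sub_ne_zero.2 hzw)
  have hp := norm_sq_sub_conj_mul_pos hR hz hw
  have h1 : 0 ≤ R ^ 2 - ‖z‖ ^ 2 := by nlinarith [norm_nonneg z]
  have h2 : R ^ 2 - ‖w‖ ^ 2 ≤ R ^ 2 := by nlinarith [norm_nonneg w]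
  have h3 : ‖(R : ℂ) ^ 2 - conj z * w‖ ≤ R * ‖z - w‖ + √(R ^ 2 - ‖z‖ ^ 2) * R := by
    refine le_of_sq_le_sq ?_ (by positivity)
    rw [norm_sq_sub_conj_mul, add_sq, mul_pow (√_), Real.sq_sqrt h1]
    have : 0 ≤ 2 * (R * ‖z - w‖) * (√(R ^ 2 - ‖z‖ ^ 2) * R) := by positivity
    nlinarith [mul_le_mul_of_nonneg_left h2 h1]
  have h4 : greenDisc R z w = Real.log (‖(R : ℂ) ^ 2 - conj z * w‖ / (R * ‖z - w‖)) := by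
    rw [Real.log_div hp.ne' (by positivity), Real.log_mul hR.ne' hd.ne', greenDisc]
    ring
  rw [h4]
  refine (Real.log_le_sub_one_of_pos (by positivity)).trans ?_
  rw [sub_le_iff_le_add, div_le_iff₀ (by positivity)]
  refine h3.trans (le_of_eq ?_)
  field_simp
  ring

/-- Both sides are the logarithm of the maximum of `r` and `d`. -/
theorem log_add_posLog_div {r d : ℝ} (hr : 0 < r) (hd : 0 < d) :
    Real.log r + Real.posLog (r⁻¹ * d) = Real.log d + Real.posLog (r / d) := by
  rw [Real.posLog, Real.posLog, Real.log_mul (by positivity) (by positivity), Real.log_inv,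
    Real.log_div hr.ne' hd.ne']
  rcases le_total (Real.log r) (Real.log d) with h | h
  · rw [max_eq_right (by linarith), max_eq_left (by linarith)]; ring
  · rw [max_eq_left (by linarith), max_eq_right (by linarith)]; ring

/-- The mean value property of `log |R² - z̄ w|`, which is harmonic in the disc: its pole `R² / w̄`
is the reflection of `w` in the boundary circle. -/
theorem circleAverage_log_norm_sq_sub {R r : ℝ} (hr : 0 < r) {a w : ℂ} (har : ‖a‖ + r < R)
    (hw : ‖w‖ < R) :
    CircleIntegrable (fun z ↦ Real.log ‖(R : ℂ) ^ 2 - conj z * w‖) a r ∧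
    Real.circleAverage (fun z ↦ Real.log ‖(R : ℂ) ^ 2 - conj z * w‖) a r =
      Real.log ‖(R : ℂ) ^ 2 - conj a * w‖ := by
  have hR : 0 < R := by linarith [norm_nonneg a]
  rcases eq_or_ne w 0 with rfl | hw0
  · simp [Real.circleAverage_const, circleIntegrable_const]
  set p : ℂ := (R : ℂ) ^ 2 / conj w with hp
  have hcw : conj w ≠ 0 := (map_ne_zero _).2 hw0
  have hwn : 0 < ‖w‖ := norm_pos_iff.2 hw0
  have hnorm : ∀ z : ℂ, ‖(R : ℂ) ^ 2 - conj z * w‖ = ‖w‖ * ‖z - p‖ := by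
    intro z
    rw [← Complex.norm_conj w, ← norm_mul, mul_sub, hp, mul_div_cancel₀ _ hcw, ← norm_neg,
      neg_sub, ← Complex.norm_conj]
    simp [mul_comm]
  have hpn : R < ‖p‖ := by
    rw [hp, norm_div, Complex.norm_conj, lt_div_iff₀ hwn, norm_pow, Complex.norm_real,
      Real.norm_of_nonneg hR.le]
    nlinarith
  have hzp : ∀ z : ℂ, ‖z‖ < R → 0 < ‖z - p‖ := fun z hz ↦
    norm_pos_iff.2 (sub_ne_zero.2 fun h ↦ by rw [h] at hz; linarith)
  have heq : EqOn (fun z ↦ Real.log ‖(R : ℂ) ^ 2 - conj z * w‖)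
      (fun z ↦ Real.log ‖w‖ + Real.log ‖z - p‖) (Metric.sphere a |r|) := by
    intro z hz
    have hz' : ‖z‖ < R := by
      rw [mem_sphere_iff_norm, abs_of_pos hr] at hz
      have := norm_add_le (z - a) a
      rw [sub_add_cancel] at this
      linarith
    simp only
    rw [hnorm, Real.log_mul hwn.ne' (hzp z hz').ne']
  have hi : CircleIntegrable (fun z ↦ Real.log ‖w‖ + Real.log ‖z - p‖) a r :=
    (circleIntegrable_const _ _ _).add (circleIntegrable_log_norm_sub_const r)
  refine ⟨(circleIntegrable_congr heq).2 hi, ?_⟩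
  have hap : r < ‖a - p‖ := by
    have := norm_sub_norm_le p a
    rw [norm_sub_rev] at this
    linarith
  rw [Real.circleAverage_congr_sphere heq, Real.circleAverage_fun_add (circleIntegrable_const _ _ _)
    (circleIntegrable_log_norm_sub_const r), Real.circleAverage_const,
    circleAverage_log_norm_sub_const_eq_log_radius_add_posLog hr.ne', hnorm,
    Real.log_mul hwn.ne' (by linarith), log_add_posLog_div hr (by linarith),
    (Real.posLog_eq_zero_iff _).2, add_zero]
  rw [abs_of_pos (by apply div_pos <;> linarith)]
  exact ((div_lt_one (by linarith)).2 hap).le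

theorem circleAverage_greenDisc {R r : ℝ} (hr : 0 < r) {a w : ℂ} (har : ‖a‖ + r < R)
    (hw : ‖w‖ < R) (haw : a ≠ w) :
    CircleIntegrable (fun z ↦ greenDisc R z w) a r ∧
    Real.circleAverage (fun z ↦ greenDisc R z w) a r =
      greenDisc R a w - Real.posLog (r / ‖a - w‖) := by
  obtain ⟨hi, hc⟩ := circleAverage_log_norm_sq_sub hr har hw
  have hi2 : CircleIntegrable
      (fun z ↦ Real.log ‖(R : ℂ) ^ 2 - conj z * w‖ - Real.log R) a r :=
    hi.sub (circleIntegrable_const (Real.log R) a r)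
  have hi3 : CircleIntegrable (fun z ↦ Real.log ‖z - w‖) a r :=
    circleIntegrable_log_norm_sub_const r
  refine ⟨hi2.sub hi3, ?_⟩
  have hd : 0 < ‖a - w‖ := norm_pos_iff.2 (sub_ne_zero.2 haw)
  unfold greenDisc
  rw [Real.circleAverage_fun_sub hi2 hi3,
    Real.circleAverage_fun_sub hi (circleIntegrable_const _ _ _),
    hc, Real.circleAverage_const, circleAverage_log_norm_sub_const_eq_log_radius_add_posLog hr.ne',
    log_add_posLog_div hr hd]
  ring

/-- Jensen's formula for the Green function, for nonnegative integrals. A pole `w` on the circle is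
excluded, because the junk value of the Green function there may be negative; such `w` form a null
set. -/
theorem lintegral_greenDisc {R r : ℝ} (hr : 0 < r) {a w : ℂ} (har : ‖a‖ + r < R)
    (hw : ‖w‖ < R) (haw : a ≠ w) (hs : w ∉ Metric.sphere a r) :
    ENNReal.ofReal (2 * Real.pi) * ENNReal.ofReal (greenDisc R a w) =
      (∫⁻ θ in Ioc 0 (2 * Real.pi), ENNReal.ofReal (greenDisc R (circleMap a r θ) w)) +
        ENNReal.ofReal (2 * Real.pi) * ENNReal.ofReal (Real.posLog (r / ‖a - w‖)) := by
  obtain ⟨hi, hc⟩ := circleAverage_greenDisc hr har hw haw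
  have hR : 0 < R := by linarith [norm_nonneg a]
  have hpi := Real.pi_pos
  have hnn : ∀ θ, 0 ≤ greenDisc R (circleMap a r θ) w := by
    intro θ
    have hm := circleMap_mem_sphere a hr.le θ
    refine greenDisc_nonneg hR ?_ hw (fun h ↦ hs (h ▸ hm))
    rw [mem_sphere_iff_norm] at hm
    have := norm_add_le (circleMap a r θ - a) a
    rw [sub_add_cancel] at this
    linarith
  have hint : IntegrableOn (fun θ ↦ greenDisc R (circleMap a r θ) w) (Ioc 0 (2 * Real.pi)) :=
    (intervalIntegrable_iff_integrableOn_Ioc_of_le (by positivity)).1 hi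
  rw [← ofReal_integral_eq_lintegral_ofReal hint (ae_of_all _ hnn),
    ← ENNReal.ofReal_mul (by positivity), ← ENNReal.ofReal_mul (by positivity),
    ← ENNReal.ofReal_add (integral_nonneg hnn) (mul_nonneg (by positivity) Real.posLog_nonneg),
    ← intervalIntegral.integral_of_le (by positivity)]
  congr 1
  rw [Real.circleAverage_def, smul_eq_mul] at hc
  field_simp at hc
  linarith

theorem lintegral_inv_norm (z : ℂ) {S : ℝ} (hS : 0 ≤ S) :
    ∫⁻ w in Metric.ball z S, ENNReal.ofReal ‖z - w‖⁻¹ = ENNReal.ofReal (2 * Real.pi * S) := by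
  have h1 : ∫⁻ w in Metric.ball z S, ENNReal.ofReal ‖z - w‖⁻¹ =
      ∫⁻ w, (Metric.ball 0 S).indicator (fun u : ℂ ↦ ENNReal.ofReal ‖u‖⁻¹) (z - w) := by
    rw [← lintegral_indicator measurableSet_ball]
    refine lintegral_congr fun w ↦ ?_
    simp only [indicator, Metric.mem_ball, dist_comm w, dist_eq_norm, sub_zero]
  rw [h1, lintegral_sub_left_eq_self (fun u ↦ (Metric.ball 0 S).indicator
    (fun u : ℂ ↦ ENNReal.ofReal ‖u‖⁻¹) u) z, ← Complex.lintegral_comp_polarCoord_symm]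
  have h2 : ∫⁻ p in polarCoord.target, ENNReal.ofReal p.1 • (Metric.ball 0 S).indicator
      (fun u : ℂ ↦ ENNReal.ofReal ‖u‖⁻¹) (Complex.polarCoord.symm p) =
      ∫⁻ p in polarCoord.target, (Iio S ×ˢ univ).indicator 1 p := by
    refine setLIntegral_congr_fun polarCoord.open_target.measurableSet fun p hp ↦ ?_
    have hp1 : 0 < p.1 := hp.1
    have hn : ‖Complex.polarCoord.symm p‖ = p.1 := by
      rw [Complex.norm_polarCoord_symm, abs_of_pos hp1]
    simp only [indicator, Metric.mem_ball, dist_zero_right, hn, mem_prod, mem_Iio, mem_univ,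
      and_true, smul_eq_mul, Pi.one_apply]
    split_ifs
    · rw [← ENNReal.ofReal_mul hp1.le, mul_inv_cancel₀ hp1.ne', ENNReal.ofReal_one]
    · rw [mul_zero]
  rw [h2, setLIntegral_indicator (measurableSet_Iio.prod MeasurableSet.univ)]
  have h3 : (Iio S ×ˢ univ) ∩ polarCoord.target = Ioo 0 S ×ˢ Ioo (-Real.pi) Real.pi := by
    ext p
    simp only [polarCoord_target, mem_inter_iff, mem_prod, mem_Iio, mem_univ, mem_Ioi, mem_Ioo]
    tauto
  rw [h3]
  simp only [Pi.one_apply, lintegral_const, one_mul, Measure.restrict_apply_univ]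
  rw [Measure.volume_eq_prod, Measure.prod_prod, Real.volume_Ioo, Real.volume_Ioo,
    ← ENNReal.ofReal_mul (by linarith)]
  congr 1
  ring

/-- The Green potential `∫ φ(w) G(z, w) dw` of the restriction of `φ` to the disc of radius `R`
about the origin. -/
def greenPotential (φ : ℂ → ℝ≥0∞) (R : ℝ) (z : ℂ) : ℝ≥0∞ :=
  ∫⁻ w in Metric.ball 0 R, φ w * ENNReal.ofReal (greenDisc R z w)

theorem measurable_greenDisc {α : Type*} [MeasurableSpace α] {f g : α → ℂ} (hf : Measurable f)
    (hg : Measurable g) (R : ℝ) : Measurable fun x ↦ greenDisc R (f x) (g x) := by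
  have h1 : Measurable fun x ↦ conj (f x) := Complex.continuous_conj.measurable.comp hf
  unfold greenDisc
  exact ((Real.measurable_log.comp (measurable_const.sub (h1.mul hg)).norm).sub_const _).sub
    (Real.measurable_log.comp (hf.sub hg).norm)

theorem greenPotential_le (hφ1 : ∀ z, φ z ≤ 1) {R : ℝ} (hR : 0 < R) {z : ℂ} (hz : ‖z‖ < R) :
    greenPotential φ R z ≤ ENNReal.ofReal (4 * Real.pi * R * √(R ^ 2 - ‖z‖ ^ 2)) := by
  calc greenPotential φ R z
      ≤ ∫⁻ w in Metric.ball 0 R, ENNReal.ofReal √(R ^ 2 - ‖z‖ ^ 2) *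
          ENNReal.ofReal ‖z - w‖⁻¹ := by
        refine lintegral_mono_ae ?_
        filter_upwards [ae_restrict_mem measurableSet_ball,
          ae_restrict_of_ae (compl_mem_ae_iff.2 (measure_singleton z))] with w hw hwz
        rw [← ENNReal.ofReal_mul (Real.sqrt_nonneg _), ← one_mul (ENNReal.ofReal (_ * _))]
        exact mul_le_mul' (hφ1 w) (ENNReal.ofReal_le_ofReal (greenDisc_le hR hz (by simpa using hw)
          fun h ↦ hwz h.symm))
    _ ≤ ∫⁻ w in Metric.ball z (2 * R), ENNReal.ofReal √(R ^ 2 - ‖z‖ ^ 2) *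
          ENNReal.ofReal ‖z - w‖⁻¹ := by
        refine lintegral_mono_set (Metric.ball_subset_ball' ?_)
        rw [dist_comm, dist_zero_right]
        linarith
    _ = _ := by
        rw [lintegral_const_mul' _ _ ENNReal.ofReal_ne_top, lintegral_inv_norm z (by positivity),
          ← ENNReal.ofReal_mul (Real.sqrt_nonneg _)]
        congr 1
        ring

theorem logMass_le_greenPotential_zero (hφ : Measurable φ) {R : ℝ} (hR : 0 < R) :
    logMass φ 0 R ≤ greenPotential φ R 0 := by
  rw [logMass_eq hφ 0 hR, greenPotential, ← lintegral_indicator measurableSet_ball]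
  refine lintegral_mono_ae ?_
  filter_upwards [compl_mem_ae_iff.2 (measure_singleton 0)] with w hw
  have hw0 : 0 < ‖w‖ := norm_pos_iff.2 hw
  rw [zero_sub, norm_neg]
  rcases lt_or_ge ‖w‖ R with h | h
  · rw [indicator_of_mem (by simpa using h), Real.posLog_eq_log, Real.log_div hR.ne' hw0.ne',
      greenDisc]
    · refine mul_le_mul_right (ENNReal.ofReal_le_ofReal (le_of_eq ?_)) _
      simp only [map_zero, zero_mul, sub_zero, norm_pow, Complex.norm_real, Real.norm_eq_abs,
        zero_sub, norm_neg, sq_abs, Real.log_pow]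
      push_cast
      ring
    · rw [abs_of_pos (by positivity)]
      exact ((one_lt_div hw0).2 h).le
  · rw [(Real.posLog_eq_zero_iff _).2]
    · simp
    · rw [abs_of_pos (by positivity)]
      exact (div_le_one hw0).2 h

/-- Jensen's formula for the Green potential: its value at `a` exceeds its mean over the circle of
radius `r` by at most `logMass φ a r`. -/
theorem greenPotential_le_circle (hφ : Measurable φ) {R r : ℝ} (hr : 0 < r) {a : ℂ}
    (har : ‖a‖ + r < R) :
    ENNReal.ofReal (2 * Real.pi) * greenPotential φ R a ≤
      (∫⁻ θ in Ioc 0 (2 * Real.pi), greenPotential φ R (circleMap a r θ)) +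
        ENNReal.ofReal (2 * Real.pi) * logMass φ a r := by
  have hmg : Measurable fun p : ℝ × ℂ ↦
      φ p.2 * ENNReal.ofReal (greenDisc R (circleMap a r p.1) p.2) := by
    have hc : Measurable fun p : ℝ × ℂ ↦ circleMap a r p.1 :=
      (continuous_circleMap a r).measurable.comp measurable_fst
    have hg : Measurable fun p : ℝ × ℂ ↦ greenDisc R (circleMap a r p.1) p.2 :=
      measurable_greenDisc hc measurable_snd R
    exact (hφ.comp measurable_snd).mul hg.ennreal_ofReal
  have hmp : Measurable fun w ↦ φ w * ENNReal.ofReal (Real.posLog (r / ‖a - w‖)) := by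
    have hl : Measurable fun w : ℂ ↦ Real.posLog (r / ‖a - w‖) :=
      measurable_const.max (Real.measurable_log.comp (by fun_prop))
    exact hφ.mul hl.ennreal_ofReal
  have h1 : ∫⁻ w in Metric.ball 0 R, φ w * ENNReal.ofReal (Real.posLog (r / ‖a - w‖)) ≤
      logMass φ a r := by
    rw [logMass_eq hφ a hr]
    exact setLIntegral_le_lintegral _ _
  refine le_trans ?_ (add_le_add_right (mul_le_mul_right h1 _) _)
  unfold greenPotential
  rw [lintegral_lintegral_swap (f := fun θ w ↦
    φ w * ENNReal.ofReal (greenDisc R (circleMap a r θ) w)) hmg.aemeasurable,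
    ← lintegral_const_mul' _ _ ENNReal.ofReal_ne_top,
    ← lintegral_const_mul' _ _ ENNReal.ofReal_ne_top,
    ← lintegral_add_right _ (hmp.const_mul _)]
  refine lintegral_mono_ae ?_
  filter_upwards [ae_restrict_mem measurableSet_ball,
    ae_restrict_of_ae (compl_mem_ae_iff.2 (measure_singleton a)),
    ae_restrict_of_ae (compl_mem_ae_iff.2 (Measure.addHaar_sphere volume a r))] with w hw hwa hws
  have hmw : Measurable fun θ ↦ ENNReal.ofReal (greenDisc R (circleMap a r θ) w) :=
    (measurable_greenDisc (continuous_circleMap a r).measurable measurable_const R).ennreal_ofReal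
  rw [lintegral_const_mul _ hmw, mul_left_comm, lintegral_greenDisc hr har (by simpa using hw)
    (fun h ↦ hwa h.symm) hws, mul_add]
  exact (add_le_add_right (le_of_eq (mul_left_comm _ _ _)) _)

end Potential

/-! ### Centres with large logarithmic means at all scales -/

section Extremal

variable {φ : ℂ → ℝ≥0∞}

theorem integral_norm_sq_circleMap (a : ℂ) (r : ℝ) :
    ∫ θ in (0)..(2 * Real.pi), ‖circleMap a r θ‖ ^ 2 = 2 * Real.pi * (‖a‖ ^ 2 + r ^ 2) := by
  have h : ∀ θ, ‖circleMap a r θ‖ ^ 2 =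
      (‖a‖ ^ 2 + r ^ 2) + ((2 * r * a.re) * Real.cos θ + (2 * r * a.im) * Real.sin θ) := by
    intro θ
    rw [Complex.sq_norm, Complex.sq_norm, Complex.normSq_apply, Complex.normSq_apply]
    simp only [circleMap, Complex.add_re, Complex.add_im, Complex.re_ofReal_mul,
      Complex.im_ofReal_mul, Complex.exp_ofReal_mul_I_re, Complex.exp_ofReal_mul_I_im]
    linear_combination r ^ 2 * Real.sin_sq_add_cos_sq θ
  simp_rw [h]
  rw [intervalIntegral.integral_add (by simp)
      (Continuous.intervalIntegrable (by fun_prop) _ _),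
    intervalIntegral.integral_add (Continuous.intervalIntegrable (by fun_prop) _ _)
      (Continuous.intervalIntegrable (by fun_prop) _ _)]
  simp
  ring

/-- If the logarithmic integral about the origin is larger at scale `R` than for the constant
density `c`, then some centre `a`, at a distance from the boundary of the disc comparable with `R`,
has up to `ε` at least the logarithmic integrals of the constant density `c` at *all* scales `r < R
- |a|`. -/
theorem exists_forall_le_logMass (hφ : Measurable φ) (hφ1 : ∀ z, φ z ≤ 1) {R c δ ε : ℝ}
    (hR : 0 < R) (hc : 0 ≤ c) (hδ : 0 < δ) (hε : 0 < ε)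
    (h : ENNReal.ofReal ((c + δ) * (Real.pi * R ^ 2 / 2)) ≤ logMass φ 0 R) :
    ∃ a : ℂ, ‖a‖ + δ ^ 2 / 512 * R ≤ R ∧ ∀ r, 0 < r → ‖a‖ + r < R →
      ENNReal.ofReal (c * (Real.pi * r ^ 2 / 2) - ε) ≤ logMass φ a r := by
  have hpi := Real.pi_pos
  set F : ℂ → ℝ := fun z ↦ (greenPotential φ R z).toReal
  have hFle : ∀ z, ‖z‖ < R → F z ≤ 4 * Real.pi * R * √(R ^ 2 - ‖z‖ ^ 2) := fun z hz ↦
    ENNReal.toReal_le_of_le_ofReal (by positivity) (greenPotential_le hφ1 hR hz)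
  have hFtop : ∀ z, ‖z‖ < R → greenPotential φ R z = ENNReal.ofReal (F z) := fun z hz ↦
    (ENNReal.ofReal_toReal ((greenPotential_le hφ1 hR hz).trans_lt ENNReal.ofReal_lt_top).ne).symm
  have hF0 : ∀ z, 0 ≤ F z := fun z ↦ ENNReal.toReal_nonneg
  -- Up to a negative multiple, the Laplacian of `H` is `φ - c`; at a maximum of `H` all circle
  -- means of `H` are at most the value at the centre.
  set H : ℂ → ℝ := fun z ↦ F z + c * (Real.pi / 2) * (‖z‖ ^ 2 - R ^ 2) with hH
  have hHF : ∀ z, ‖z‖ < R → H z ≤ F z := by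
    intro z hz
    have : ‖z‖ ^ 2 - R ^ 2 ≤ 0 := by nlinarith [norm_nonneg z]
    have := mul_nonpos_of_nonneg_of_nonpos (show 0 ≤ c * (Real.pi / 2) by positivity) this
    simp only [hH]; linarith
  have hbdd : BddAbove (H '' Metric.ball 0 R) := by
    refine ⟨4 * Real.pi * R * R, ?_⟩
    rintro _ ⟨z, hz, rfl⟩
    rw [mem_ball_zero_iff] at hz
    refine (hHF z hz).trans ((hFle z hz).trans ?_)
    refine mul_le_mul_of_nonneg_left (Real.sqrt_le_iff.2 ⟨hR.le, ?_⟩) (by positivity)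
    nlinarith [norm_nonneg z]
  set M := sSup (H '' Metric.ball 0 R)
  have hM : ∀ z, ‖z‖ < R → H z ≤ M := fun z hz ↦
    le_csSup hbdd (mem_image_of_mem H (mem_ball_zero_iff.2 hz))
  have hH0 : δ * (Real.pi * R ^ 2 / 2) ≤ H 0 := by
    have h1 := h.trans (logMass_le_greenPotential_zero hφ hR)
    rw [hFtop 0 (by simpa using hR), ENNReal.ofReal_le_ofReal_iff (hF0 0)] at h1
    simp only [hH, norm_zero]
    linarith
  -- The second bound on the error keeps `F a` of size `R²`, and so `a` away from the boundary.
  set η := min ε (δ * (Real.pi * R ^ 2 / 4)) with hη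
  have hηpos : 0 < η := lt_min hε (by positivity)
  obtain ⟨_, ⟨a, ha, rfl⟩, haM⟩ := exists_lt_of_lt_csSup
    ⟨H 0, mem_image_of_mem H (Metric.mem_ball_self hR)⟩ (show M - η < M by linarith)
  rw [mem_ball_zero_iff] at ha
  have hη1 : η ≤ ε := min_le_left _ _
  have hη2 : η ≤ δ * (Real.pi * R ^ 2 / 4) := min_le_right _ _
  refine ⟨a, ?_, fun r hr har ↦ ?_⟩
  · have h0M := hM 0 (by simpa using hR)
    have h1 : δ * (Real.pi * R ^ 2 / 4) ≤ 4 * Real.pi * R * √(R ^ 2 - ‖a‖ ^ 2) := by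
      have := hHF a ha
      have := hFle a ha
      linarith
    have h2 : δ * R / 16 ≤ √(R ^ 2 - ‖a‖ ^ 2) := by
      have h3 : (4 * Real.pi * R) * (δ * R / 16) ≤
          (4 * Real.pi * R) * √(R ^ 2 - ‖a‖ ^ 2) := by
        refine le_trans (le_of_eq ?_) h1
        ring
      exact le_of_mul_le_mul_left h3 (by positivity)
    have h4 : (δ * R / 16) ^ 2 ≤ R ^ 2 - ‖a‖ ^ 2 := by
      rwa [Real.le_sqrt' (by positivity)] at h2
    have h5 : (2 * R) * (δ ^ 2 / 512 * R) ≤ (2 * R) * (R - ‖a‖) := by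
      nlinarith [norm_nonneg a]
    have := le_of_mul_le_mul_left h5 (by positivity)
    linarith
  · have hcirc : ∀ θ, ‖circleMap a r θ‖ < R := by
      intro θ
      have hm := circleMap_mem_sphere a hr.le θ
      rw [mem_sphere_iff_norm] at hm
      have := norm_add_le (circleMap a r θ - a) a
      rw [sub_add_cancel] at this
      linarith
    set B : ℝ → ℝ := fun θ ↦ M - c * (Real.pi / 2) * (‖circleMap a r θ‖ ^ 2 - R ^ 2) with hB
    have hBc : Continuous B := by fun_prop
    have hFB : ∀ θ, F (circleMap a r θ) ≤ B θ := by
      intro θ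
      have := hM _ (hcirc θ)
      simp only [hH] at this
      simp only [hB]
      linarith
    have hBint : ∫ θ in Ioc 0 (2 * Real.pi), B θ =
        2 * Real.pi * (M - c * (Real.pi / 2) * (‖a‖ ^ 2 + r ^ 2 - R ^ 2)) := by
      rw [← intervalIntegral.integral_of_le (by positivity)]
      simp only [hB]
      rw [intervalIntegral.integral_sub (by simp)
        (Continuous.intervalIntegrable (by fun_prop) _ _), intervalIntegral.integral_const_mul,
        intervalIntegral.integral_sub (Continuous.intervalIntegrable (by fun_prop) _ _) (by simp),
        integral_norm_sq_circleMap]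
      simp
      ring
    have h1 := greenPotential_le_circle hφ hr har
    have h2 : ∫⁻ θ in Ioc 0 (2 * Real.pi), greenPotential φ R (circleMap a r θ) ≤
        ENNReal.ofReal (2 * Real.pi * (M - c * (Real.pi / 2) * (‖a‖ ^ 2 + r ^ 2 - R ^ 2))) := by
      rw [← hBint, ofReal_integral_eq_lintegral_ofReal
        (hBc.integrableOn_Icc.mono_set Ioc_subset_Icc_self)
        (ae_of_all _ fun θ ↦ (hF0 _).trans (hFB θ))]
      refine lintegral_mono fun θ ↦ ?_
      rw [hFtop _ (hcirc θ)]
      exact ENNReal.ofReal_le_ofReal (hFB θ)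
    rcases eq_or_ne (logMass φ a r) ⊤ with htop | htop
    · rw [htop]; exact le_top
    rw [← ENNReal.ofReal_toReal htop] at h1 ⊢
    set ℓ := (logMass φ a r).toReal
    have hℓ : 0 ≤ ℓ := ENNReal.toReal_nonneg
    have h3 := h1.trans (add_le_add_left h2 _)
    have h4 : 0 ≤ ∫ θ in Ioc 0 (2 * Real.pi), B θ :=
      integral_nonneg fun θ ↦ (hF0 _).trans (hFB θ)
    rw [hBint] at h4
    rw [hFtop a ha, ← ENNReal.ofReal_mul (by positivity), ← ENNReal.ofReal_mul (by positivity),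
      ← ENNReal.ofReal_add h4 (by positivity), ENNReal.ofReal_le_ofReal_iff (by positivity),
      ← mul_add] at h3
    have h5 := le_of_mul_le_mul_left h3 (by positivity)
    refine ENNReal.ofReal_le_ofReal ?_
    simp only [hH] at haM
    linarith

end Extremal

/-! ### Energy densities of Brody curves -/

section Translation

theorem ballMass_comp_add (φ : ℂ → ℝ≥0∞) (a b : ℂ) (R : ℝ) :
    ballMass (fun z ↦ φ (z + a)) b R = ballMass φ (b + a) R := by
  unfold ballMass
  rw [← lintegral_indicator measurableSet_ball, ← lintegral_indicator measurableSet_ball,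
    ← lintegral_add_right_eq_self (fun z ↦ (Metric.ball (b + a) R).indicator φ z) a]
  refine lintegral_congr fun z ↦ ?_
  simp only [indicator, Metric.mem_ball, dist_add_right]

theorem logMass_comp_add (φ : ℂ → ℝ≥0∞) (a b : ℂ) (R : ℝ) :
    logMass (fun z ↦ φ (z + a)) b R = logMass φ (b + a) R := by
  unfold logMass
  simp_rw [ballMass_comp_add]

end Translation

section Curves

variable {E : Type*} [NormedAddCommGroup E] [NormedSpace ℂ E]
  {X : Type*} [TopologicalSpace X] [ChartedSpace E X] [IsManifold 𝓘(ℂ, E) ω X]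

/-- The density `|df|²` of the energy of a Brody curve. -/
def energyDensity (g : HermitianMetric E X) (f : brodyCurves g) (z : ℂ) : ℝ≥0∞ :=
  ENNReal.ofReal (sphericalDeriv g f.1 z ^ 2)

variable {g : HermitianMetric E X}

theorem energyDensity_le_one (f : brodyCurves g) (z : ℂ) : energyDensity g f z ≤ 1 := by
  refine ENNReal.ofReal_le_one.2 ?_
  have h0 : 0 ≤ sphericalDeriv g f.1 z := Real.sqrt_nonneg _
  have h1 := f.2.2 z
  nlinarith

theorem energyDensity_vadd (f : brodyCurves g) (a : ℂ) :
    energyDensity g (a +ᵥ f) = fun z ↦ energyDensity g f (z + a) := by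
  ext z
  unfold energyDensity
  rw [sphericalDeriv_vadd]

theorem measurable_energyDensity [CompleteSpace E] (f : brodyCurves g) :
    Measurable (energyDensity g f) :=
  ((continuous_sphericalDeriv_apply g f).pow 2).measurable.ennreal_ofReal

theorem energy_eq (f : brodyCurves g) (a : ℂ) (R : ℝ) :
    energy g f a R = ballMass (energyDensity g f) a R := rfl

theorem energy_vadd (f : brodyCurves g) (a b : ℂ) (R : ℝ) :
    energy g (a +ᵥ f) b R = energy g f (b + a) R := by
  rw [energy_eq, energyDensity_vadd, ballMass_comp_add, energy_eq]

theorem rho_eq [CompleteSpace E] (f : brodyCurves g) :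
    rho g f = massDensity (energyDensity g f) :=
  (tendsto_meanMass (measurable_energyDensity f)).limUnder_eq

theorem tendsto_meanEnergy [CompleteSpace E] (f : brodyCurves g) :
    Tendsto (meanEnergy g f) atTop (𝓝 (rho g f)) := by
  rw [rho_eq]
  exact tendsto_meanMass (measurable_energyDensity f)

theorem rho_le_one [CompleteSpace E] (f : brodyCurves g) : rho g f ≤ 1 := by
  rw [rho_eq]
  exact massDensity_le_one (energyDensity_le_one f)

theorem energy_div_le (f : brodyCurves g) {t : ℝ} (ht : 0 < t) :
    energy g f 0 t / ENNReal.ofReal t ≤ ENNReal.ofReal Real.pi * ENNReal.ofReal t := by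
  rw [← ofReal_mul_sq_div ht Real.pi_pos.le]
  exact ENNReal.div_le_div_right (ballMass_le (energyDensity_le_one f) 0 ht.le) _

/-- Starting the integral of the characteristic at `1` instead of `0` loses at most `π / 2`, since
`|df| ≤ 1`. -/
theorem logMass_le_nsaCharacteristic (f : brodyCurves g) {r : ℝ} (hr : 1 ≤ r) :
    logMass (energyDensity g f) 0 r ≤ nsaCharacteristic g r f + ENNReal.ofReal (Real.pi / 2) := by
  unfold logMass
  rw [← Ioc_union_Ioc_eq_Ioc zero_le_one hr, add_comm]
  refine (lintegral_union_le _ _ _).trans (add_le_add ?_ le_rfl)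
  calc ∫⁻ t in Ioc (0 : ℝ) 1, ballMass (energyDensity g f) 0 t / ENNReal.ofReal t
      ≤ ∫⁻ t in Ioc (0 : ℝ) 1, ENNReal.ofReal Real.pi * ENNReal.ofReal t :=
        setLIntegral_mono' measurableSet_Ioc fun t ht ↦ energy_div_le f ht.1
    _ = ENNReal.ofReal (Real.pi / 2) := by
        rw [lintegral_Ioc_mul_ofReal zero_le_one, ← ENNReal.ofReal_mul Real.pi_pos.le]
        congr 1
        ring

theorem rhoNSA_le_rho [CompleteSpace E] (f : brodyCurves g) : rhoNSA g f ≤ rho g f := by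
  have hpi := Real.pi_pos
  refine le_of_forall_gt_imp_ge_of_dense fun b hb ↦ ?_
  obtain ⟨t₀, ht₀⟩ := eventually_atTop.1 ((tendsto_meanEnergy f).eventually_lt_const hb)
  set t₁ := max t₀ 1
  have ht₁ : 0 < t₁ := one_pos.trans_le (le_max_right _ _)
  have hT : ∀ r, 0 ≤ r → nsaCharacteristic g r f ≤
      ENNReal.ofReal Real.pi * ENNReal.ofReal (t₁ ^ 2 / 2) +
        (b * ENNReal.ofReal Real.pi) * ENNReal.ofReal (r ^ 2 / 2) := by
    intro r hr
    have hsub : Ioc 1 r ⊆ Ioc 0 t₁ ∪ Ioc t₁ r := fun t ht ↦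
      (le_or_gt t t₁).imp (fun h ↦ ⟨one_pos.trans ht.1, h⟩) fun h ↦ ⟨h, ht.2⟩
    refine (lintegral_mono_set hsub).trans ((lintegral_union_le _ _ _).trans (add_le_add ?_ ?_))
    · rw [← lintegral_Ioc_mul_ofReal ht₁.le]
      exact setLIntegral_mono' measurableSet_Ioc fun t ht ↦ energy_div_le f ht.1
    · rw [← lintegral_Ioc_mul_ofReal hr]
      refine le_trans ?_ (lintegral_mono_set (Ioc_subset_Ioc_left ht₁.le))
      refine setLIntegral_mono' measurableSet_Ioc fun t ht ↦ ?_
      have ht0 : 0 < t := ht₁.trans ht.1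
      have h1 : energy g f 0 t ≤ ENNReal.ofReal (Real.pi * t ^ 2) * b :=
        (ballMass_le_meanMass _ 0 ht0).trans
          (mul_le_mul_right (ht₀ t ((le_max_left _ _).trans ht.1.le)).le _)
      refine (ENNReal.div_le_div_right h1 _).trans (le_of_eq ?_)
      rw [mul_comm, mul_div_assoc, ofReal_mul_sq_div ht0 hpi.le, mul_assoc]
  have hlim : Tendsto (fun r : ℝ ↦ ENNReal.ofReal (t₁ ^ 2 / r ^ 2) + b) atTop (𝓝 b) := by
    have h1 : Tendsto (fun r : ℝ ↦ t₁ ^ 2 / r ^ 2) atTop (𝓝 0) :=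
      tendsto_const_nhds.div_atTop (tendsto_pow_atTop two_ne_zero)
    simpa using (ENNReal.tendsto_ofReal h1).add_const b
  rw [← hlim.limsup_eq]
  refine limsup_le_limsup ?_
  filter_upwards [eventually_gt_atTop 0] with r hr
  refine (mul_le_mul_right (hT r hr.le) _).trans (le_of_eq ?_)
  rw [mul_add, mul_assoc b, mul_left_comm _ b, ← ENNReal.ofReal_mul hpi.le,
    ← ENNReal.ofReal_mul hpi.le, ← ENNReal.ofReal_mul (by positivity),
    ← ENNReal.ofReal_mul (by positivity)]
  have h2 : 2 / (Real.pi * r ^ 2) * (Real.pi * (r ^ 2 / 2)) = 1 := by field_simp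
  have h3 : 2 / (Real.pi * r ^ 2) * (Real.pi * (t₁ ^ 2 / 2)) = t₁ ^ 2 / r ^ 2 := by field_simp
  rw [h2, h3, ENNReal.ofReal_one, mul_one]

theorem lowerRhoNSA_le_rhoNSA (f : brodyCurves g) : lowerRhoNSA g f ≤ rhoNSA g f :=
  liminf_le_limsup

variable [CompleteSpace E] [T2Space X] [CompactSpace X]

theorem continuous_energy (a : ℂ) (R : ℝ) : Continuous fun f : brodyCurves g ↦ energy g f a R := by
  have := firstCountableTopology_brodyCurves g
  refine continuous_iff_continuousAt.2 fun f ↦ ?_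
  refine tendsto_lintegral_filter_of_dominated_convergence 1
    (Eventually.of_forall measurable_energyDensity)
    (Eventually.of_forall fun h ↦ ae_of_all _ (energyDensity_le_one h)) ?_ ?_
  · simp only [Pi.one_apply, lintegral_one, Measure.restrict_apply_univ]
    exact measure_ball_lt_top.ne
  · exact ae_of_all _ fun z ↦ ENNReal.tendsto_ofReal
      (((continuous_sphericalDeriv g z).tendsto f).pow 2)

theorem continuous_nsaCharacteristic (r : ℝ) :
    Continuous fun f : brodyCurves g ↦ nsaCharacteristic g r f := by
  have := firstCountableTopology_brodyCurves g
  refine continuous_iff_continuousAt.2 fun f ↦ ?_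
  refine tendsto_lintegral_filter_of_dominated_convergence
    (fun t ↦ ENNReal.ofReal Real.pi * ENNReal.ofReal t) (Eventually.of_forall fun h ↦ ?_)
    (Eventually.of_forall fun h ↦ ?_) ?_ ?_
  · exact (((measurable_ballMass (measurable_energyDensity h)).comp
      (measurable_const.prodMk measurable_id)).div ENNReal.measurable_ofReal)
  · filter_upwards [ae_restrict_mem measurableSet_Ioc] with t ht
    exact energy_div_le h (one_pos.trans ht.1)
  · rcases le_or_gt r 0 with hr | hr
    · rw [Ioc_eq_empty (by linarith)]
      simp
    · refine ((lintegral_mono_set (Ioc_subset_Ioc_left zero_le_one)).trans_lt ?_).ne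
      rw [lintegral_Ioc_mul_ofReal hr.le]
      exact ENNReal.mul_lt_top ENNReal.ofReal_lt_top ENNReal.ofReal_lt_top
  · filter_upwards [ae_restrict_mem measurableSet_Ioc] with t ht
    refine ENNReal.Tendsto.div_const ((continuous_energy 0 t).tendsto f) (Or.inr ?_)
    exact (ENNReal.ofReal_pos.2 (one_pos.trans ht.1)).ne'

/-- Bounds of all energies at a fixed radius are closed and translation invariant conditions. -/
theorem rho_le_of_mem_orbitClosure {f h : brodyCurves g} (hh : h ∈ orbitClosure g f) :
    rho g h ≤ rho g f := by
  refine le_of_tendsto_of_tendsto' (tendsto_meanEnergy h) (tendsto_meanEnergy f) fun R ↦ ?_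
  refine mul_le_mul_right (iSup_le fun a ↦ ?_) _
  have hcl : IsClosed {h : brodyCurves g | energy g h a R ≤ ⨆ b, energy g f b R} :=
    isClosed_le (continuous_energy a R) continuous_const
  refine closure_minimal ?_ hcl hh
  rintro _ ⟨b, rfl⟩
  change energy g (b +ᵥ f) a R ≤ _
  rw [energy_vadd]
  exact le_iSup (fun b ↦ energy g f b R) (a + b)

omit [T2Space X] [CompactSpace X] in
/-- Some translate of `f` has a large logarithmic integral at all radii up to a multiple of `R`. -/
theorem exists_orbit_le_logMass (f : brodyCurves g) {c δ R : ℝ} (hc : 0 ≤ c) (hδ : 0 < δ)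
    (hR : 0 < R) (hρ : ENNReal.ofReal (c + δ) < rho g f) :
    ∃ h ∈ AddAction.orbit ℂ f, ∀ r, 0 < r → r < δ ^ 2 / 512 * R →
      ENNReal.ofReal (c * (Real.pi * r ^ 2 / 2) - 1) ≤ logMass (energyDensity g h) 0 r := by
  have hpi := Real.pi_pos
  have h1 : ENNReal.ofReal (c + δ) * ENNReal.ofReal (Real.pi * R ^ 2 / 2) <
      ⨆ a, logMass (energyDensity g f) a R := by
    refine lt_of_lt_of_le ?_ (massDensity_mul_le_iSup_logMass (measurable_energyDensity f) hR)
    rw [← rho_eq]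
    exact (ENNReal.mul_lt_mul_iff_left (ENNReal.ofReal_pos.2 (by positivity)).ne'
      ENNReal.ofReal_ne_top).2 hρ
  obtain ⟨b, hb⟩ := lt_iSup_iff.1 h1
  have h2 : ENNReal.ofReal ((c + δ) * (Real.pi * R ^ 2 / 2)) ≤
      logMass (energyDensity g (b +ᵥ f)) 0 R := by
    rw [ENNReal.ofReal_mul (by positivity), energyDensity_vadd, logMass_comp_add, zero_add]
    exact hb.le
  obtain ⟨a, ha, hlog⟩ := exists_forall_le_logMass (measurable_energyDensity (b +ᵥ f))
    (energyDensity_le_one _) hR hc hδ one_pos h2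
  refine ⟨(a + b) +ᵥ f, ⟨a + b, rfl⟩, fun r hr hrR ↦ ?_⟩
  rw [add_vadd, energyDensity_vadd, logMass_comp_add, zero_add]
  exact hlog r hr (by linarith)

/-- A limit of the translates in `exists_orbit_le_logMass` as `R → ∞` has a large characteristic at
all radii. -/
theorem exists_le_lowerRhoNSA (f : brodyCurves g) {c δ : ℝ} (hc : 0 ≤ c) (hδ : 0 < δ)
    (hρ : ENNReal.ofReal (c + δ) < rho g f) :
    ∃ h ∈ orbitClosure g f, ENNReal.ofReal c ≤ lowerRhoNSA g h := by
  have hpi := Real.pi_pos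
  have := seqCompactSpace_brodyCurves g
  choose h hmem hlog using fun n : ℕ ↦
    exists_orbit_le_logMass f hc hδ (show (0 : ℝ) < n + 1 by positivity) hρ
  obtain ⟨k, ψ, hψ, hlim⟩ := SeqCompactSpace.tendsto_subseq h
  refine ⟨k, mem_closure_of_tendsto hlim (Eventually.of_forall fun n ↦ hmem _), ?_⟩
  have hk : ∀ r : ℝ, 1 ≤ r →
      ENNReal.ofReal (c * (Real.pi * r ^ 2 / 2) - 1 - Real.pi / 2) ≤ nsaCharacteristic g r k := by
    intro r hr
    refine ge_of_tendsto (((continuous_nsaCharacteristic r).tendsto k).comp hlim) ?_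
    have hev : ∀ᶠ n : ℕ in atTop, r < δ ^ 2 / 512 * ((ψ n : ℝ) + 1) := by
      have : Tendsto (fun n : ℕ ↦ δ ^ 2 / 512 * ((ψ n : ℝ) + 1)) atTop atTop :=
        ((tendsto_natCast_atTop_atTop.comp hψ.tendsto_atTop).atTop_add
          tendsto_const_nhds).const_mul_atTop (by positivity)
      exact this.eventually_gt_atTop r
    filter_upwards [hev] with n hn
    rw [ENNReal.ofReal_sub _ (by positivity)]
    exact tsub_le_iff_right.2 ((hlog (ψ n) r (by linarith) hn).trans
      (logMass_le_nsaCharacteristic _ hr))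
  have hlim2 : Tendsto (fun r : ℝ ↦ ENNReal.ofReal (c - (2 + Real.pi) / (Real.pi * r ^ 2))) atTop
      (𝓝 (ENNReal.ofReal c)) := by
    refine ENNReal.tendsto_ofReal ?_
    have h1 : Tendsto (fun r : ℝ ↦ (2 + Real.pi) / (Real.pi * r ^ 2)) atTop (𝓝 0) :=
      tendsto_const_nhds.div_atTop ((tendsto_pow_atTop two_ne_zero).const_mul_atTop hpi)
    simpa using h1.const_sub c
  rw [← hlim2.liminf_eq]
  refine liminf_le_liminf ?_
  filter_upwards [eventually_ge_atTop 1] with r hr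
  refine le_trans (le_of_eq ?_) (mul_le_mul_right (hk r hr) _)
  rw [← ENNReal.ofReal_mul (by positivity)]
  congr 1
  field_simp
  ring

theorem rho_le_lowerRhoNSASet (f : brodyCurves g) :
    rho g f ≤ lowerRhoNSASet g (orbitClosure g f) := by
  refine le_of_forall_lt fun b hb ↦ ?_
  obtain ⟨b₁, hb₁, hb₁'⟩ := exists_between hb
  obtain ⟨b₂, hb₂, hb₂'⟩ := exists_between hb₁'
  have h2 : b₂ ≠ ⊤ := hb₂'.ne_top
  have h1 : b₁ ≠ ⊤ := hb₂.ne_top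
  have hlt : b₁.toReal < b₂.toReal := (ENNReal.toReal_lt_toReal h1 h2).2 hb₂
  obtain ⟨h, hh, hle⟩ := exists_le_lowerRhoNSA f (c := b₁.toReal) (δ := b₂.toReal - b₁.toReal)
    ENNReal.toReal_nonneg (sub_pos.2 hlt) (by
      rwa [add_sub_cancel, ENNReal.ofReal_toReal h2])
  rw [ENNReal.ofReal_toReal h1] at hle
  exact hb₁.trans_le (hle.trans (le_biSup (lowerRhoNSA g) hh))

omit [CompleteSpace E] [T2Space X] [CompactSpace X] in
theorem lowerRhoNSASet_le_rhoNSASet (N : Set (brodyCurves g)) :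
    lowerRhoNSASet g N ≤ rhoNSASet g N :=
  iSup₂_mono fun f _ ↦ lowerRhoNSA_le_rhoNSA f

omit [T2Space X] [CompactSpace X] in
theorem rhoNSASet_le_rhoSet (N : Set (brodyCurves g)) : rhoNSASet g N ≤ rhoSet g N :=
  iSup₂_mono fun f _ ↦ rhoNSA_le_rho f

omit [T2Space X] [CompactSpace X] in
theorem rhoSet_ne_top (N : Set (brodyCurves g)) : rhoSet g N ≠ ⊤ :=
  ((iSup₂_le fun f _ ↦ rho_le_one f).trans_lt ENNReal.one_lt_top).ne

theorem rhoSet_orbitClosure (f : brodyCurves g) : rhoSet g (orbitClosure g f) = rho g f :=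
  le_antisymm (iSup₂_le fun _ hh ↦ rho_le_of_mem_orbitClosure hh)
    (le_biSup (rho g) (subset_closure (AddAction.mem_orbit_self f)))

theorem rhoSet_le_lowerRhoNSASet {N : Set (brodyCurves g)}
    (hN : ∀ f ∈ N, orbitClosure g f ⊆ N) : rhoSet g N ≤ lowerRhoNSASet g N :=
  iSup₂_le fun f hf ↦ (rho_le_lowerRhoNSASet f).trans (biSup_mono (hN f hf))

end Curves

end Brody

end

theorem theorem1 {E : Type*} [NormedAddCommGroup E] [NormedSpace ℂ E] [FiniteDimensional ℂ E]
    {X : Type*} [TopologicalSpace X] [T2Space X] [CompactSpace X] [ChartedSpace E X]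
    [IsManifold 𝓘(ℂ, E) ω X] (g : Brody.HermitianMetric E X) :
    (∀ f : Brody.brodyCurves g,
      Tendsto (Brody.meanEnergy g f) atTop (𝓝 (Brody.rho g f)) ∧
      Brody.rho g f ≠ ⊤ ∧
      Brody.rho g f = Brody.rhoSet g (Brody.orbitClosure g f) ∧
      Brody.rhoSet g (Brody.orbitClosure g f) = Brody.rhoNSASet g (Brody.orbitClosure g f) ∧
      Brody.rhoNSASet g (Brody.orbitClosure g f) =
        Brody.lowerRhoNSASet g (Brody.orbitClosure g f)) ∧
    (∀ N : Set (Brody.brodyCurves g), IsClosed N → (∀ a : ℂ, ∀ f ∈ N, a +ᵥ f ∈ N) →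
      Brody.rhoSet g N ≠ ⊤ ∧
      Brody.rhoSet g N = Brody.rhoNSASet g N ∧
      Brody.rhoNSASet g N = Brody.lowerRhoNSASet g N) := by
  have : CompleteSpace E := FiniteDimensional.complete ℂ E
  have hclosed : ∀ N : Set (Brody.brodyCurves g), IsClosed N → (∀ a : ℂ, ∀ f ∈ N, a +ᵥ f ∈ N) →
      Brody.rhoSet g N = Brody.rhoNSASet g N ∧
      Brody.rhoNSASet g N = Brody.lowerRhoNSASet g N := by
    intro N hN hinv
    have h1 : Brody.rhoSet g N ≤ Brody.lowerRhoNSASet g N :=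
      Brody.rhoSet_le_lowerRhoNSASet fun f hf ↦ closure_minimal (by
        rintro _ ⟨a, rfl⟩
        exact hinv a f hf) hN
    have h2 := Brody.lowerRhoNSASet_le_rhoNSASet N
    have h3 := Brody.rhoNSASet_le_rhoSet N
    exact ⟨le_antisymm (h1.trans h2) h3, le_antisymm (h3.trans h1) h2⟩
  refine ⟨fun f ↦ ?_, fun N hN hinv ↦ ⟨Brody.rhoSet_ne_top N, hclosed N hN hinv⟩⟩
  have hinv : ∀ a : ℂ, ∀ h ∈ Brody.orbitClosure g f, a +ᵥ h ∈ Brody.orbitClosure g f := by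
    intro a h hh
    refine map_mem_closure (Brody.continuous_vadd_right g a) hh ?_
    rintro _ ⟨b, rfl⟩
    exact ⟨a + b, add_vadd a b f⟩
  exact ⟨Brody.tendsto_meanEnergy f, ((Brody.rho_le_one f).trans_lt ENNReal.one_lt_top).ne,
    (Brody.rhoSet_orbitClosure f).symm, hclosed _ isClosed_closure hinv⟩
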